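/- **Notation.** Let $V=\{1,\dots,d\}$ and let $\|\cdot\|$ be any fixed norm on $\mathbb R^d$. A Lévy measure is a Borel measure $\Lambda$ on $\mathbb R^d$ with $\Lambda(\{0\})=0$ and $\int (1\wedge\|x\|^2)\,\Lambda(dx)<\infty$. A Lévy process is an $\mathbb R^d$-valued process $\mathbf X=(X(t))_{t\ge0}$ with $X(0)=0$ almost surely, independent and stationary increments, and almost surely càdlàg paths. It has characteristic triplet $(\gamma,\Sigma,\Lambda)$ if $$\mathbb E\,e^{i\langle u,X(1)\rangle}=\exp\Big(i\langle u,\gamma\rangle-\tfrac12\langle u,\Sigma u\rangle+\int_{\mathbb R^d}\big(e^{i\langle u,x\rangle}-1-i\langle u,x\rangle\mathbf 1_{\{\|x\|\le1\}}\big)\Lambda(dx)\Big),\qquad u\in\mathbb R^d .$$ The marginal tail functions of $\Lambda$ are $U_i(x)=\Lambda(y: y_i\ge x,\ y_i\neq0)$ for $x\ge0$ and $U_i(x)=\Lambda(y: y_i\le x)$ for $x<0$. For $s\in\{+1,-1\}^d$ put $\mathcal O_s=\{x: \text{for every } i,\ s_ix_i>0,\text{ or } x_i=0\text{ and }s_i=+1\}$.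 A standardized Lévy measure is a Lévy measure $\Lambda^*$ with $\Lambda^*(y: y_i>x)=\Lambda^*(y: y_i<-x)=1/x$ for all $x>0$, $i\in V$. **Heterogeneous stable processes.** Let $\Lambda^*$ be a standardized Lévy measure with $\Lambda^*(hE)=h^{-1}\Lambda^*(E)$ for all $h>0$ and Borel $E\subseteq\mathbb R^d$. For $i\in V$ let $\alpha_i\in(0,2)$ and $c_i^+,c_i^->0$. Let $\Lambda$ be the Lévy measure with marginal tail functions $U_i(\pm x)=c_i^{\pm}|x|^{-\alpha_i}$, $x\ge0$ (equal to $\infty$ at $0$), such that for every $s\in\{+1,-1\}^d$ and $x\in\mathcal O_s$ $$\Lambda(y: s_iy_i\ge s_ix_i\ \text{for all } i\in V)=\Lambda^*\big(y: s_iy_i\ge 1/U_i(x_i)\ \text{for all } i\in V\big),\qquad 1/\infty:=0 .$$ A heterogeneous stable process is a Lévy process $\mathbf X$ with characteristic triplet $(0,0,\Lambda)$. **Proposition 5.2.** Let $\mathbf X$ be a heterogeneous stable process with Lévy measure $\Lambda$. Then: 1. For all $D\subseteq V$ and $i\in D$, $\Lambda_D^0(x_i\ne0)\in\{0,\infty\}$,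 where $\Lambda_D^0=\Lambda(x_D\in\cdot,\ x_{V\setminus D}=0)$, as a measure on $\mathbb R^D\setminus\{0\}$ (assumption [A2]). 2. There is a function $\gamma:[0,\infty)\to\mathbb R^d$ such that for every $t\ge0$ $$X(t)\stackrel d=\big(t^{1/\alpha_i}X_i(1)+\gamma_i(t)\big)_{i\in V}.$$ 3. $\mathbf X$ has time-invariant copulas. That is, for each $t>0$ there is exactly one copula $C_t$ of $X(t)$, and $C_t=C_1$ for all $t>0$. Here a copula is the distribution function on $[0,1]^d$ of a probability measure with uniform marginals, and $C$ is a copula of $Y$ if $\mathbb P(Y_1\le x_1,\dots,Y_d\le x_d)=C(F_1(x_1),\dots,F_d(x_d))$ for all $x\in\mathbb R^d$, with $F_i$ the distribution function of $Y_i$. -/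

import Mathlib

open MeasureTheory ProbabilityTheory Filter Topology
open scoped NNReal ENNReal Pointwise

noncomputable section

namespace HeteroStable

/-- `ℝ^d`, with coordinates indexed by `V = Fin d`. -/
abbrev Vec (d : ℕ) : Type := EuclideanSpace ℝ (Fin d)

/-! ### Lévy measures and Lévy processes -/

/-- A Lévy measure on `ℝ^d`: no mass at the origin and `∫ min(1, ‖x‖²) Λ(dx) < ∞`. The condition does
not depend on the choice of the norm. -/
structure IsLevyMeasure {d : ℕ} (Λ : Measure (Vec d)) : Prop where
  zero : Λ {0} = 0
  integrability : ∫⁻ x, ENNReal.ofReal (min 1 (‖x‖ ^ 2)) ∂Λ < ∞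

/-- A Lévy process in `ℝ^d`: it starts at zero almost surely, has independent and stationary
increments, and almost surely càdlàg paths. -/
structure IsLevyProcess {d : ℕ} {Ω : Type*} [MeasurableSpace Ω]
    (X : ℝ≥0 → Ω → Vec d) (P : Measure Ω) : Prop where
  measurable : ∀ t, Measurable (X t)
  zero : ∀ᵐ ω ∂P, X 0 ω = 0
  indep_increments : HasIndepIncrements X P
  stationary_increments : ∀ s t : ℝ≥0,
    P.map (fun ω => X (t + s) ω - X s ω) = P.map (fun ω => X t ω - X 0 ω)
  cadlag : ∀ᵐ ω ∂P, ∀ t : ℝ≥0,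
    ContinuousWithinAt (fun s => X s ω) (Set.Ici t) t ∧
      ∃ l, Tendsto (fun s => X s ω) (𝓝[<] t) (𝓝 l)

/-- The Lévy–Khintchine exponent of the triplet `(γ, Q, Λ)`, small jumps (`N x ≤ 1`) being compensated
with respect to the norm `N`. -/
def levyKhintchineExponent {d : ℕ} (N : Seminorm ℝ (Vec d)) (γ : Vec d)
    (Q : Matrix (Fin d) (Fin d) ℝ) (Λ : Measure (Vec d)) (u : Vec d) : ℂ :=
  Complex.I * (inner ℝ u γ : ℝ)
    - ((1 / 2 * dotProduct u.ofLp (Q.mulVec u.ofLp) : ℝ) : ℂ)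
    + ∫ x, (Complex.exp (Complex.I * (inner ℝ u x : ℝ)) - 1
        - Set.indicator {x : Vec d | N x ≤ 1}
            (fun x => Complex.I * ((inner ℝ u x : ℝ) : ℂ)) x) ∂Λ

/-- The process `X` has characteristic triplet `(γ, Q, Λ)` (with respect to the norm `N`): the
characteristic function of `X 1` is given by the Lévy–Khintchine formula. -/
structure HasCharacteristicTriplet {d : ℕ} {Ω : Type*} [MeasurableSpace Ω]
    (N : Seminorm ℝ (Vec d)) (X : ℝ≥0 → Ω → Vec d) (P : Measure Ω) (γ : Vec d)
    (Q : Matrix (Fin d) (Fin d) ℝ) (Λ : Measure (Vec d)) : Prop where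
  posSemidef : Q.PosSemidef
  isLevyMeasure : IsLevyMeasure Λ
  charFun_eq : ∀ u : Vec d,
    charFun (P.map (X 1)) u = Complex.exp (levyKhintchineExponent N γ Q Λ u)

/-! ### Standardized Lévy measures -/

/-- The orthant of the sign vector `s`; a vanishing coordinate counts as positive. -/
def orthant {d : ℕ} (s : Fin d → ℤˣ) : Set (Vec d) :=
  {x | ∀ i, 0 < ((s i : ℤ) : ℝ) * x i ∨ (x i = 0 ∧ s i = 1)}

/-- The `i`-th marginal tail function: `U_i(x) = Λ_i([x, ∞))` for `x ≥ 0` and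
`U_i(x) = Λ_i((-∞, x])` for `x < 0`, where `Λ_i` is the `i`-th marginal measure on `ℝ ∖ {0}`. -/
def tailFunction {d : ℕ} (Λ : Measure (Vec d)) (i : Fin d) (x : ℝ) : ℝ≥0∞ :=
  if 0 ≤ x then Λ {y | x ≤ y i ∧ y i ≠ 0} else Λ {y | y i ≤ x ∧ y i ≠ 0}

/-- A standardized Lévy measure: both tails of every marginal at `x > 0` are `1 / x`. -/
structure IsStandardized {d : ℕ} (Λs : Measure (Vec d)) : Prop where
  isLevyMeasure : IsLevyMeasure Λs
  upper : ∀ (i : Fin d) (x : ℝ), 0 < x → Λs {y | x < y i} = ENNReal.ofReal (1 / x)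
  lower : ∀ (i : Fin d) (x : ℝ), 0 < x → Λs {y | y i < -x} = ENNReal.ofReal (1 / x)

/-- `Λs` carries the dependence structure of `Λ`: for every sign vector `s` and all `x ∈ O_s`,
`Λ(y : s_i y_i ≥ s_i x_i ∀ i) = Λs(y : s_i y_i ≥ 1 / U_i(x_i) ∀ i)`, with `U_i` the marginal tail
functions of `Λ`, and `1 / ∞ = 0`, `1 / 0 = ∞`. -/
def IsStandardizationOf {d : ℕ} (Λs Λ : Measure (Vec d)) : Prop :=
  ∀ (s : Fin d → ℤˣ), ∀ x ∈ orthant s,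
    Λ {y | ∀ i, ((s i : ℤ) : ℝ) * x i ≤ ((s i : ℤ) : ℝ) * y i} =
      Λs {y | ∀ i, (((tailFunction Λ i (x i))⁻¹ : ℝ≥0∞) : EReal) ≤
        ((((s i : ℤ) : ℝ) * y i : ℝ) : EReal)}

/-- `Λ (h E) = h⁻¹ Λ E` for all `h > 0` and all Borel sets `E`. -/
def IsNegOneHomogeneous {d : ℕ} (Λ : Measure (Vec d)) : Prop :=
  ∀ h : ℝ, 0 < h → ∀ E : Set (Vec d), MeasurableSet E →
    Λ (h • E) = ENNReal.ofReal h⁻¹ * Λ E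

/-- The stable tail function `U(x) = c⁺ |x|^(-α)` for `x ≥ 0` and `c⁻ |x|^(-α)` for `x < 0`, with
value `∞` at `0` (for `c⁺, α > 0`). -/
def stableTail (cp cm α : ℝ) (x : ℝ) : ℝ≥0∞ :=
  (if 0 ≤ x then ENNReal.ofReal cp else ENNReal.ofReal cm) * ENNReal.ofReal |x| ^ (-α)

/-- `Λ` is the Lévy measure with stable marginal tail functions of indices `α_i ∈ (0, 2)` and scales
`c_i^± > 0`, whose dependence is given by the `-1`-homogeneous standardized Lévy measure `Λs`. -/
structure IsHeteroStableMeasure {d : ℕ} (Λs : Measure (Vec d)) (α cp cm : Fin d → ℝ)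
    (Λ : Measure (Vec d)) : Prop where
  standardized : IsStandardized Λs
  homogeneous : IsNegOneHomogeneous Λs
  index_mem : ∀ i, α i ∈ Set.Ioo (0 : ℝ) 2
  cp_pos : ∀ i, 0 < cp i
  cm_pos : ∀ i, 0 < cm i
  isLevyMeasure : IsLevyMeasure Λ
  tail_eq : ∀ i x, tailFunction Λ i x = stableTail (cp i) (cm i) (α i) x
  isStandardizationOf : IsStandardizationOf Λs Λ

/-- A heterogeneous stable process: a Lévy process with characteristic triplet `(0, 0, Λ)`, where
`Λ` is a heterogeneous stable Lévy measure. -/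
structure IsHeteroStableProcess {d : ℕ} {Ω : Type*} [MeasurableSpace Ω]
    (N : Seminorm ℝ (Vec d)) (Λs : Measure (Vec d)) (α cp cm : Fin d → ℝ)
    (Λ : Measure (Vec d)) (X : ℝ≥0 → Ω → Vec d) (P : Measure Ω) : Prop where
  measure : IsHeteroStableMeasure Λs α cp cm Λ
  isLevyProcess : IsLevyProcess X P
  triplet : HasCharacteristicTriplet N X P 0 0 Λ

/-! ### The explosiveness assumption -/

/-- The measure `Λ_D^0 = Λ(x_D ∈ ·, x_{V ∖ D} = 0)` on `ℝ^D ∖ {0}`. -/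
def marginalZero {d : ℕ} (Λ : Measure (Vec d)) (D : Finset (Fin d)) : Measure (D → ℝ) :=
  ((Λ.restrict {x | ∀ j, j ∉ D → x j = 0}).map (fun x (i : D) => x i)).restrict {0}ᶜ

/-- `Λ_D^0(x_i ≠ 0) ∈ {0, ∞}` for all `D ⊆ V` and `i ∈ D`. -/
def Explosive {d : ℕ} (Λ : Measure (Vec d)) : Prop :=
  ∀ (D : Finset (Fin d)) (i : D),
    marginalZero Λ D {y | y i ≠ 0} = 0 ∨ marginalZero Λ D {y | y i ≠ 0} = ∞

/-! ### Copulas -/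

/-- A copula: the distribution function, on the unit cube, of a probability measure whose
one-dimensional marginals are all uniform on `[0, 1]`. -/
def IsCopula {d : ℕ} (C : (Fin d → unitInterval) → ℝ) : Prop :=
  ∃ μ : Measure (Fin d → ℝ), IsProbabilityMeasure μ ∧
    (∀ i, μ.map (fun y => y i) = volume.restrict (Set.Icc (0 : ℝ) 1)) ∧
    ∀ u, C u = μ.real {y | ∀ i, y i ≤ u i}

/-- The marginal distribution function `x ↦ P(Y_i ≤ x)`, with values in `[0, 1]`. -/
def marginalCDF {d : ℕ} {Ω : Type*} [MeasurableSpace Ω] (Y : Ω → Vec d) (P : Measure Ω)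
    (i : Fin d) (x : ℝ) : unitInterval :=
  ⟨cdf (P.map (fun ω => Y ω i)) x, cdf_nonneg _ x, cdf_le_one _ x⟩

/-- `C` is a copula of the random vector `Y`:
`P(Y_1 ≤ x_1, …, Y_d ≤ x_d) = C(F_1(x_1), …, F_d(x_d))` for all `x`. -/
def IsCopulaOf {d : ℕ} {Ω : Type*} [MeasurableSpace Ω] (C : (Fin d → unitInterval) → ℝ)
    (Y : Ω → Vec d) (P : Measure Ω) : Prop :=
  IsCopula C ∧ ∀ x : Fin d → ℝ,
    P.real {ω | ∀ i, Y ω i ≤ x i} = C (fun i => marginalCDF Y P i (x i))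

end HeteroStable

end

/-! Everything rests on operator self-similarity of `Λ`: with `A_t = diag(t^(1/α_i))`, the image of
`Λ` under `A_t` is `t Λ` (`map_scaling`). On tail sets this is a computation: moving the base point
from `x` to `A_t⁻¹ x` multiplies every threshold `1 / U_i` by `t⁻¹`, and homogeneity of `Λs` turns
this dilation into the factor `t`. Tail sets based in their own orthant form a generating π-system,
which gives equality of measures.

Explosiveness: the sets involved are invariant under `A_2`, so their mass `m` satisfies `m = 2 m`.

Marginal laws: if `ψ` is the Lévy–Khintchine exponent, then `X t` has characteristic function `exp
(t ψ)`. Self-similarity gives `t ψ(u) = ψ(A_t u) + i⟨u, γ⟩`; the drift `γ` appears because the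
truncation set `{N ≤ 1}` is not invariant under `A_t`.

Copulas: increasing affine maps of the coordinates preserve copulas, so it suffices that `X 1` has
exactly one. By Sklar's theorem this follows from atomless marginals. The `i`-th marginal has
`|φ(r)| = exp (r^(α_i) Re ψ(e_i))` for `r > 0`, with `Re ψ(e_i) < 0`; this tends to zero, and
Wiener's mean value formula then excludes atoms. -/

noncomputable section

namespace HeteroStable

/-! ### Tail sets determine a measure. -/

section

variable {d : ℕ}

/-- The set of points whose coordinates lie beyond those of `x`, in the directions given by the sign
vector `s`. -/
def tailSet (s : Fin d → ℤˣ) (x : Vec d) : Set (Vec d) :=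
  {y | ∀ i, ((s i : ℤ) : ℝ) * x i ≤ ((s i : ℤ) : ℝ) * y i}

lemma measurable_coord (i : Fin d) : Measurable fun y : Vec d => y i := by fun_prop

lemma measurableSet_tailSet (s : Fin d → ℤˣ) (x : Vec d) : MeasurableSet (tailSet s x) := by
  rw [tailSet, Set.ofPred_forall]
  refine MeasurableSet.iInter fun i => measurableSet_le measurable_const ?_
  exact (measurable_coord i).const_mul _

lemma tailSet_subset_orthant {s : Fin d → ℤˣ} {x : Vec d} (hx : x ∈ orthant s) :
    tailSet s x ⊆ orthant s := by
  intro y hy i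
  have h1 := hx i
  have h2 := hy i
  rcases Int.units_eq_one_or (s i) with h | h <;> simp only [h] at h1 h2 ⊢
  · simp only [Units.val_one, Int.cast_one, one_mul, and_true] at h1 h2 ⊢
    rcases h1 with h1 | h1
    · left; linarith
    · rcases h2.eq_or_lt with h2 | h2
      · right; linarith
      · left; linarith
  · rcases h1 with h1 | h1
    · left; linarith
    · exact absurd h1.2 (by decide)

lemma orthant_sign_unique {s s' : Fin d → ℤˣ} {y : Vec d} (h : y ∈ orthant s)
    (h' : y ∈ orthant s') : s = s' := by
  ext1 i
  have h1 := h i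
  have h2 := h' i
  rcases Int.units_eq_one_or (s i) with e | e <;> rcases Int.units_eq_one_or (s' i) with e' | e' <;>
    simp only [e, e'] at h1 h2 ⊢
  · have : ¬ ((-1 : ℤˣ) = 1) := by decide
    simp [this] at h1 h2
    rcases h1 with h1 | h1 <;> linarith
  · have : ¬ ((-1 : ℤˣ) = 1) := by decide
    simp [this] at h1 h2
    rcases h2 with h1 | h1 <;> linarith

/-- The tail sets based at points of their own orthant. -/
def tailSets (d : ℕ) : Set (Set (Vec d)) :=
  {E | ∃ s : Fin d → ℤˣ, ∃ x ∈ orthant s, E = tailSet s x}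

/-- A tail set stays inside the orthant of its base point and orthants are disjoint, so two tail
sets that meet share their sign vector. Their intersection is based at the coordinatewise farther of
the two points. -/
lemma isPiSystem_tailSets : IsPiSystem (tailSets d) := by
  rintro _ ⟨s, x, hx, rfl⟩ _ ⟨s', x', hx', rfl⟩ ⟨y, hy, hy'⟩
  obtain rfl := orthant_sign_unique (tailSet_subset_orthant hx hy) (tailSet_subset_orthant hx' hy')
  refine ⟨s, WithLp.toLp 2 fun i =>
    if ((s i : ℤ) : ℝ) * x i ≤ ((s i : ℤ) : ℝ) * x' i then x' i else x i, fun i => ?_, ?_⟩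
  · dsimp only
    split_ifs
    exacts [hx' i, hx i]
  · ext z
    simp only [tailSet, Set.mem_inter_iff, Set.mem_ofPred_eq, ← forall_and]
    refine forall_congr' fun i => ?_
    split_ifs with h
    · exact ⟨fun hz => hz.2, fun hz => ⟨h.trans hz, hz⟩⟩
    · exact ⟨fun hz => hz.1, fun hz => ⟨hz, (not_le.1 h).le.trans hz⟩⟩

/-- Every point lies in a tail set whose base point has rational coordinates, vanishing only where
the coordinates of the point do. -/
lemma exists_rat_mem_tailSet (y : Vec d) : ∃ (s : Fin d → ℤˣ) (q : Fin d → ℚ),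
    (WithLp.toLp 2 fun i => (q i : ℝ)) ∈ orthant s ∧
      y ∈ tailSet s (WithLp.toLp 2 fun i => (q i : ℝ)) ∧ ∀ i, q i = 0 → y i = 0 := by
  have key : ∀ i, ∃ (a : ℤˣ) (q : ℚ), (0 < ((a : ℤ) : ℝ) * q ∨ ((q : ℝ) = 0 ∧ a = 1)) ∧
      ((a : ℤ) : ℝ) * q ≤ ((a : ℤ) : ℝ) * y i ∧ (q = 0 → y i = 0) := by
    intro i
    rcases lt_trichotomy (y i) 0 with h | h | h
    · obtain ⟨q, h1, h2⟩ := exists_rat_btwn h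
      exact ⟨-1, q, by simpa using h2, by simpa using h1.le, by rintro rfl; simp at h2⟩
    · exact ⟨1, 0, by simp, by simp [h], fun _ => h⟩
    · obtain ⟨q, h1, h2⟩ := exists_rat_btwn h
      exact ⟨1, q, by simp [h1], by simpa using h2.le, by rintro rfl; simp at h1⟩
  choose s q h1 h2 h3 using key
  exact ⟨s, q, h1, h2, h3⟩

/-- The half-space is a countable union of tail sets: the `i`-th sign and base coordinate are held
fixed while the others run over signs and rationals. -/
lemma measurableSet_generateFrom_tailSets_coord (i : Fin d) (a : ℤˣ) (r : ℝ)
    (h : 0 < ((a : ℤ) : ℝ) * r ∨ (r = 0 ∧ a = 1)) :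
    MeasurableSet[MeasurableSpace.generateFrom (tailSets d)]
      {y : Vec d | ((a : ℤ) : ℝ) * r ≤ ((a : ℤ) : ℝ) * y i} := by
  have : {y : Vec d | ((a : ℤ) : ℝ) * r ≤ ((a : ℤ) : ℝ) * y i} =
      ⋃ p : {p : (Fin d → ℤˣ) × (Fin d → ℚ) // (WithLp.toLp 2 fun j =>
        Function.update (fun j => (p.2 j : ℝ)) i r j) ∈ orthant (Function.update p.1 i a)},
        tailSet (Function.update p.1.1 i a) (WithLp.toLp 2 fun j =>
        Function.update (fun j => (p.1.2 j : ℝ)) i r j) := by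
    ext y
    simp only [Set.mem_ofPred_eq, Set.mem_iUnion]
    constructor
    · intro hy
      obtain ⟨s, q, h1, h2, -⟩ := exists_rat_mem_tailSet y
      refine ⟨⟨⟨s, q⟩, fun j => ?_⟩, fun j => ?_⟩
      · rcases eq_or_ne j i with rfl | hj
        · simpa using h
        · simpa [hj] using h1 j
      · rcases eq_or_ne j i with rfl | hj
        · simpa using hy
        · simpa [hj] using h2 j
    · rintro ⟨p, hp⟩
      simpa using hp i
  rw [this]
  refine MeasurableSet.iUnion fun p => ?_
  exact MeasurableSpace.measurableSet_generateFrom ⟨_, _, p.2, rfl⟩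

lemma measurable_of_measurableSet_le {β : Type*} [MeasurableSpace β] {f : β → Fin d → ℝ}
    (h : ∀ i r, MeasurableSet {y | r ≤ f y i}) : Measurable f :=
  measurable_pi_iff.2 fun i => measurable_of_Ici fun r => h i r

lemma generateFrom_tailSets :
    (inferInstance : MeasurableSpace (Vec d)) = MeasurableSpace.generateFrom (tailSets d) := by
  apply le_antisymm
  · have h : @Measurable _ _ (MeasurableSpace.generateFrom (tailSets d)) _
        (fun y : Vec d => y.ofLp) := by
      refine @measurable_of_measurableSet_le _ _ (MeasurableSpace.generateFrom (tailSets d)) _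
        fun i r => ?_
      rcases le_or_gt 0 r with hr | hr
      · have := measurableSet_generateFrom_tailSets_coord i 1 r
          (by simpa [eq_comm] using hr.lt_or_eq)
        simpa using this
      -- Half-spaces cut out by tail sets point away from the origin, so a negative threshold is
      -- reached through complements of `{y i ≤ q}` with `q < r` rational.
      · have : {y : Vec d | r ≤ y i} =
            (⋃ q : {q : ℚ // (q : ℝ) < r}, {y : Vec d | (((-1 : ℤˣ) : ℤ) : ℝ) * (q : ℚ)
              ≤ (((-1 : ℤˣ) : ℤ) : ℝ) * y i})ᶜ := by
          ext y
          simp only [Set.mem_compl_iff, Set.mem_iUnion,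
            Set.mem_ofPred_eq, not_exists, Units.val_neg, Units.val_one, Int.cast_neg, Int.cast_one,
            neg_mul, one_mul, neg_le_neg_iff, not_le, Subtype.forall]
          refine ⟨fun h q hq => hq.trans_le h, fun h => ?_⟩
          by_contra hlt
          obtain ⟨q, h1, h2⟩ := exists_rat_btwn (not_le.1 hlt)
          exact lt_asymm h1 (h q h2)
        rw [this]
        refine (MeasurableSet.iUnion fun q => ?_).compl
        refine measurableSet_generateFrom_tailSets_coord i (-1) _ (Or.inl ?_)
        have := q.2
        simp only [Units.val_neg, Units.val_one, Int.cast_neg, Int.cast_one, neg_mul, one_mul]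
        linarith
    exact MeasurableSpace.comap_le_iff_le_map.2 fun E hE => h hE
  · refine MeasurableSpace.generateFrom_le ?_
    rintro _ ⟨s, x, -, rfl⟩
    exact measurableSet_tailSet s x

/-- Two measures without mass at the origin coincide if they agree on all tail sets, provided the
values at base points other than the origin are finite. -/
theorem measure_ext_of_tailSet {μ ν : Measure (Vec d)} (hμ : μ {0} = 0) (hν : ν {0} = 0)
    (hfin : ∀ s, ∀ x ∈ orthant s, x ≠ 0 → μ (tailSet s x) ≠ ∞)
    (heq : ∀ s, ∀ x ∈ orthant s, μ (tailSet s x) = ν (tailSet s x)) : μ = ν := by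
  -- The tail set based at the origin may have infinite mass, so it is left out of the cover; the
  -- null set `{0}` replaces it.
  let T : Set (Set (Vec d)) := insert {0} (Set.range fun p : {p : (Fin d → ℤˣ) × (Fin d → ℚ) //
    (WithLp.toLp 2 fun i => (p.2 i : ℝ)) ∈ orthant p.1 ∧ p.2 ≠ 0} =>
      tailSet p.1.1 (WithLp.toLp 2 fun i => (p.1.2 i : ℝ)))
  have hT : ∀ t ∈ T, t = {0} ∨ ∃ s, ∃ x ∈ orthant s, x ≠ 0 ∧ t = tailSet s x := by
    rintro t (rfl | ⟨⟨p, hp, hp0⟩, rfl⟩)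
    · exact Or.inl rfl
    · refine Or.inr ⟨_, _, hp, fun h => hp0 ?_, rfl⟩
      ext1 i
      simpa using congrArg (fun z : Vec d => z i) h
  refine Measure.ext_of_generateFrom_of_cover (S := tailSets d) (T := T) generateFrom_tailSets
    ((Set.countable_range _).insert _) isPiSystem_tailSets ?_ ?_ ?_ ?_
  · refine Set.eq_univ_of_forall fun y => ?_
    by_cases hy : y = 0
    · exact ⟨{0}, Set.mem_insert _ _, hy⟩
    · obtain ⟨s, q, h1, h2, h3⟩ := exists_rat_mem_tailSet y
      refine ⟨_, Set.mem_insert_of_mem _ ⟨⟨⟨s, q⟩, h1, fun h => hy ?_⟩, rfl⟩, h2⟩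
      ext i
      exact h3 i (congrFun h i)
  · intro t ht
    rcases hT t ht with rfl | ⟨s, x, hx, h0, rfl⟩
    · simp [hμ]
    · exact hfin s x hx h0
  · intro t ht E hE
    rcases hT t ht with rfl | ⟨s, x, hx, h0, rfl⟩
    · rw [measure_mono_null Set.inter_subset_right hμ, measure_mono_null Set.inter_subset_right hν]
    · rcases Set.eq_empty_or_nonempty (E ∩ tailSet s x) with he | hne
      · simp [he]
      · obtain ⟨s', x', hx', h'⟩ := isPiSystem_tailSets E hE _ ⟨s, x, hx, rfl⟩ hne
        rw [h', heq _ _ hx']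
  · intro t ht
    rcases hT t ht with rfl | ⟨s, x, hx, h0, rfl⟩
    · rw [hμ, hν]
    · exact heq s x hx

/-! ### Operator self-similarity of the Lévy measure and explosiveness. -/

/-- Coordinatewise scaling by powers of `t`. -/
def scaling (α : Fin d → ℝ) (t : ℝ) (x : Vec d) : Vec d :=
  WithLp.toLp 2 fun i => t ^ (1 / α i) * x i

@[simp] lemma scaling_apply (α : Fin d → ℝ) (t : ℝ) (x : Vec d) (i : Fin d) :
    scaling α t x i = t ^ (1 / α i) * x i := rfl

lemma continuous_scaling (α : Fin d → ℝ) (t : ℝ) : Continuous (scaling α t) := by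
  unfold scaling; fun_prop

lemma measurable_scaling (α : Fin d → ℝ) (t : ℝ) : Measurable (scaling α t) :=
  (continuous_scaling α t).measurable

lemma scaling_eq_zero {α : Fin d → ℝ} {t : ℝ} (ht : 0 < t) {x : Vec d} :
    scaling α t x = 0 ↔ x = 0 := by
  constructor
  · intro h
    ext i
    have : t ^ (1 / α i) * x i = 0 := congrArg (fun z : Vec d => z i) h
    simpa [(Real.rpow_pos_of_pos ht _).ne'] using this
  · rintro rfl
    ext i
    simp

lemma inner_scaling (α : Fin d → ℝ) (t : ℝ) (x y : Vec d) :
    inner ℝ (scaling α t x) y = inner ℝ x (scaling α t y) := by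
  simp only [PiLp.inner_apply, scaling_apply, RCLike.inner_apply, conj_trivial]
  exact Finset.sum_congr rfl fun i _ => by ring

/-- The thresholds `1 / U_i` are finite reals, including at `x = 0`, where `1 / ∞ = 0`. The
extended-real condition in the standardization thus becomes a real inequality. -/
lemma inv_stableTail {cp cm α : ℝ} (hp : 0 < cp) (hm : 0 < cm) (hα : 0 < α) (x : ℝ) :
    (stableTail cp cm α x)⁻¹ = ENNReal.ofReal (|x| ^ α / if 0 ≤ x then cp else cm) := by
  have hc : (if 0 ≤ x then ENNReal.ofReal cp else ENNReal.ofReal cm) =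
      ENNReal.ofReal (if 0 ≤ x then cp else cm) := by split_ifs <;> rfl
  have hpos : 0 < (if 0 ≤ x then cp else cm) := by split_ifs <;> assumption
  rw [stableTail, hc, ENNReal.rpow_neg, ENNReal.mul_inv, inv_inv,
    ENNReal.ofReal_rpow_of_nonneg (abs_nonneg x) hα.le, ENNReal.ofReal_div_of_pos hpos, mul_comm,
    div_eq_mul_inv]
  · exact Or.inl (by simpa using hpos)
  · exact Or.inl ENNReal.ofReal_ne_top

lemma stableTail_ne_top {cp cm α : ℝ} (hp : 0 < cp) (hm : 0 < cm) (hα : 0 < α) {x : ℝ}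
    (hx : x ≠ 0) : stableTail cp cm α x ≠ ∞ := by
  rw [← ENNReal.inv_ne_zero, inv_stableTail hp hm hα]
  have hpos : 0 < (if 0 ≤ x then cp else cm) := by split_ifs <;> assumption
  have := Real.rpow_pos_of_pos (abs_pos.2 hx) α
  simpa using div_pos this hpos

namespace IsHeteroStableMeasure

variable {Λs Λ : Measure (Vec d)} {α cp cm : Fin d → ℝ}

lemma index_pos (h : IsHeteroStableMeasure Λs α cp cm Λ) (i : Fin d) : 0 < α i := (h.index_mem i).1

lemma measure_tailSet (h : IsHeteroStableMeasure Λs α cp cm Λ) {s : Fin d → ℤˣ} {x : Vec d}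
    (hx : x ∈ orthant s) : Λ (tailSet s x) =
      Λs {y | ∀ i, |x i| ^ α i / (if 0 ≤ x i then cp i else cm i) ≤ ((s i : ℤ) : ℝ) * y i} := by
  rw [tailSet, h.isStandardizationOf s x hx]
  congr 1
  ext y
  refine forall_congr' fun i => ?_
  have hpos : 0 < (if 0 ≤ x i then cp i else cm i) := by
    split_ifs
    exacts [h.cp_pos i, h.cm_pos i]
  rw [h.tail_eq, inv_stableTail (h.cp_pos i) (h.cm_pos i) (h.index_pos i),
    EReal.coe_ennreal_ofReal, EReal.coe_le_coe_iff, max_eq_left]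
  exact div_nonneg (Real.rpow_nonneg (abs_nonneg _) _) hpos.le

/-- One nonzero coordinate of the base point suffices: the tail set then lies in a one-coordinate
tail, whose mass is finite. -/
lemma measure_tailSet_ne_top (h : IsHeteroStableMeasure Λs α cp cm Λ) {s : Fin d → ℤˣ} {x : Vec d}
    (hx : x ∈ orthant s) (h0 : x ≠ 0) : Λ (tailSet s x) ≠ ∞ := by
  obtain ⟨i, hi⟩ : ∃ i, x i ≠ 0 := by
    by_contra! hcon
    exact h0 (by ext i; exact hcon i)
  have hfin : tailFunction Λ i (x i) ≠ ∞ := by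
    rw [h.tail_eq]
    exact stableTail_ne_top (h.cp_pos i) (h.cm_pos i) (h.index_pos i) hi
  refine ne_top_of_le_ne_top hfin ?_
  rw [tailFunction]
  have hxi := hx i
  simp only [hi, false_and, or_false] at hxi
  rcases Int.units_eq_one_or (s i) with e | e <;> simp only [e] at hxi
  · simp only [Units.val_one, Int.cast_one, one_mul] at hxi
    rw [if_pos hxi.le]
    refine measure_mono fun y hy => ?_
    have := hy i
    simp only [e, Units.val_one, Int.cast_one, one_mul] at this
    exact ⟨this, (hxi.trans_le this).ne'⟩
  · simp only [Units.val_neg, Units.val_one, Int.cast_neg, Int.cast_one, neg_mul, one_mul,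
      neg_pos] at hxi
    rw [if_neg hxi.not_ge]
    refine measure_mono fun y hy => ?_
    have := hy i
    simp only [e, Units.val_neg, Units.val_one, Int.cast_neg, Int.cast_one, neg_mul, one_mul,
      neg_le_neg_iff] at this
    exact ⟨this, (this.trans_lt hxi).ne⟩

/-- The Lévy measure of a heterogeneous stable process is operator self-similar. -/
theorem map_scaling (h : IsHeteroStableMeasure Λs α cp cm Λ) {t : ℝ} (ht : 0 < t) :
    Λ.map (scaling α t) = ENNReal.ofReal t • Λ := by
  symm
  refine measure_ext_of_tailSet ?_ ?_ ?_ ?_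
  · simp [h.isLevyMeasure.zero]
  · rw [Measure.map_apply (measurable_scaling α t) (measurableSet_singleton _)]
    have : scaling α t ⁻¹' {0} = {0} := by
      ext x
      exact scaling_eq_zero ht
    rw [this, h.isLevyMeasure.zero]
  · intro s x hx h0
    simpa using ENNReal.mul_ne_top ENNReal.ofReal_ne_top (h.measure_tailSet_ne_top hx h0)
  · intro s x hx
    have hpow : ∀ i, 0 < t ^ (1 / α i) := fun i => Real.rpow_pos_of_pos ht _
    set x' : Vec d := WithLp.toLp 2 fun i => x i / t ^ (1 / α i) with hx'
    have hx'i : ∀ i, x' i = x i / t ^ (1 / α i) := fun i => rfl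
    have hx'o : x' ∈ orthant s := by
      intro i
      rcases hx i with hi | hi
      · left
        rw [hx'i, ← mul_div_assoc]
        exact div_pos hi (hpow i)
      · right
        rw [hx'i]
        simp [hi]
    have hpre : scaling α t ⁻¹' tailSet s x = tailSet s x' := by
      ext y
      refine forall_congr' fun i => ?_
      rw [scaling_apply, hx'i, ← mul_div_assoc, div_le_iff₀ (hpow i)]
      ring_nf
    have hsc : ∀ i, |x' i| ^ α i / (if 0 ≤ x' i then cp i else cm i) =
        t⁻¹ * (|x i| ^ α i / (if 0 ≤ x i then cp i else cm i)) := by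
      intro i
      have hsgn : (0 ≤ x' i) ↔ (0 ≤ x i) := by
        rw [hx'i, le_div_iff₀ (hpow i), zero_mul]
      have hpw : (t ^ (1 / α i)) ^ α i = t := by
        rw [← Real.rpow_mul ht.le, one_div_mul_cancel (h.index_pos i).ne', Real.rpow_one]
      simp only [hsgn]
      rw [hx'i, abs_div, abs_of_pos (hpow i), Real.div_rpow (abs_nonneg _) (hpow i).le, hpw]
      ring
    rw [Measure.map_apply (measurable_scaling α t) (measurableSet_tailSet _ _), hpre,
      h.measure_tailSet hx'o, Measure.smul_apply, h.measure_tailSet hx, smul_eq_mul]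
    set E : Set (Vec d) :=
      {y | ∀ i, |x i| ^ α i / (if 0 ≤ x i then cp i else cm i) ≤ ((s i : ℤ) : ℝ) * y i} with hE
    have hEm : MeasurableSet E := by
      rw [hE, Set.ofPred_forall]
      refine MeasurableSet.iInter fun i => measurableSet_le measurable_const ?_
      exact (measurable_coord i).const_mul _
    -- The thresholds at `x'` are `t⁻¹` times those at `x`, so the set to be measured is `t⁻¹ • E`.
    have hh := h.homogeneous t⁻¹ (inv_pos.2 ht) E hEm
    rw [inv_inv] at hh
    rw [← hh]
    congr 1
    ext y
    rw [Set.mem_smul_set_iff_inv_smul_mem₀ (inv_pos.2 ht).ne', inv_inv]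
    refine forall_congr' fun i => ?_
    rw [hsc, PiLp.smul_apply, smul_eq_mul, inv_mul_le_iff₀ ht]
    ring_nf

/-- Sets invariant under the scalings have measure `0` or `∞`. -/
lemma measure_eq_zero_or_top (h : IsHeteroStableMeasure Λs α cp cm Λ) {E : Set (Vec d)}
    (hE : MeasurableSet E) (hinv : scaling α 2 ⁻¹' E = E) : Λ E = 0 ∨ Λ E = ∞ := by
  have h2 : Λ E = ENNReal.ofReal 2 * Λ E := by
    conv_lhs => rw [← hinv, ← Measure.map_apply (measurable_scaling α 2) hE,
      h.map_scaling two_pos, Measure.smul_apply, smul_eq_mul]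
  by_contra! hcon
  have h3 := congrArg ENNReal.toReal h2
  rw [ENNReal.toReal_mul, ENNReal.toReal_ofReal (by norm_num)] at h3
  have := ENNReal.toReal_pos hcon.1 hcon.2
  linarith

theorem explosive (h : IsHeteroStableMeasure Λs α cp cm Λ) : Explosive Λ := by
  intro D i
  have hm : Measurable (fun (x : Vec d) (i : D) => x i) := by fun_prop
  have hD : MeasurableSet {x : Vec d | ∀ j, j ∉ D → x j = 0} := by
    simp only [Set.ofPred_forall]
    exact MeasurableSet.iInter fun j => MeasurableSet.iInter fun _ =>
      measurable_coord j (measurableSet_singleton 0)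
  have hi : MeasurableSet {y : D → ℝ | y i ≠ 0} :=
    measurableSet_eq_fun (measurable_pi_apply i) measurable_const |>.compl
  have hval : marginalZero Λ D {y | y i ≠ 0} =
      Λ ({x | x i ≠ 0} ∩ {x | ∀ j, j ∉ D → x j = 0}) := by
    rw [marginalZero, Measure.restrict_apply hi, Set.inter_eq_left.2,
      Measure.map_apply hm hi, Measure.restrict_apply (hm hi)]
    · rfl
    · rintro y hy rfl
      exact hy rfl
  rw [hval]
  have hi' : MeasurableSet {x : Vec d | x i ≠ 0} :=
    measurableSet_eq_fun (measurable_coord (i : Fin d)) measurable_const |>.compl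
  refine h.measure_eq_zero_or_top (hi'.inter hD) ?_
  ext x
  have hpow : ∀ i, (2 : ℝ) ^ (1 / α i) ≠ 0 := fun i => (Real.rpow_pos_of_pos two_pos _).ne'
  simp [-one_div, hpow]

end IsHeteroStableMeasure

end

/-! ### The Lévy–Khintchine integral and its behaviour under scaling. -/

section

variable {d : ℕ} {N : Seminorm ℝ (Vec d)} {Λ : Measure (Vec d)}

lemma continuous_seminorm (N : Seminorm ℝ (Vec d)) : Continuous N :=
  N.convexOn.locallyLipschitz.continuous

/-- By compactness `N` has a positive minimum on the Euclidean unit sphere. The sphere is empty only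
when `d = 0`. -/
lemma exists_norm_le_of_seminorm_le_one (hN : ∀ x, N x = 0 → x = 0) :
    ∃ R : ℝ, 1 ≤ R ∧ ∀ x, N x ≤ 1 → ‖x‖ ≤ R := by
  rcases (Metric.sphere (0 : Vec d) 1).eq_empty_or_nonempty with he | hne
  · refine ⟨1, le_rfl, fun x _ => ?_⟩
    by_contra! hx
    have : ‖x‖⁻¹ • x ∈ Metric.sphere (0 : Vec d) 1 := by
      rw [mem_sphere_zero_iff_norm, norm_smul, norm_inv, norm_norm, inv_mul_cancel₀]
      linarith
    simp [he] at this
  · obtain ⟨z, hz, hmin⟩ := (isCompact_sphere (0 : Vec d) 1).exists_isMinOn hne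
      (continuous_seminorm N).continuousOn
    have hz1 : ‖z‖ = 1 := by simpa using hz
    have hpos : 0 < N z := by
      refine lt_of_le_of_ne (apply_nonneg N z) fun h => ?_
      rw [hN z h.symm, norm_zero] at hz1
      exact zero_ne_one hz1
    refine ⟨max 1 (N z)⁻¹, le_max_left _ _, fun x hx => ?_⟩
    rcases eq_or_ne x 0 with rfl | h0
    · rw [norm_zero]; positivity
    have hxn : 0 < ‖x‖ := norm_pos_iff.2 h0
    have hmem : ‖x‖⁻¹ • x ∈ Metric.sphere (0 : Vec d) 1 := by
      rw [mem_sphere_zero_iff_norm, norm_smul, norm_inv, norm_norm, inv_mul_cancel₀ hxn.ne']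
    have h1 : N z ≤ N (‖x‖⁻¹ • x) := hmin hmem
    rw [map_smul_eq_mul, norm_inv, norm_norm, inv_mul_eq_div, le_div_iff₀ hxn] at h1
    refine le_trans ?_ (le_max_right _ _)
    rw [← one_div, le_div_iff₀ hpos]
    linarith

lemma exists_seminorm_le_one_of_norm_lt (N : Seminorm ℝ (Vec d)) :
    ∃ r : ℝ, 0 < r ∧ ∀ x, ‖x‖ < r → N x ≤ 1 := by
  have h : ∀ᶠ x in 𝓝 (0 : Vec d), N x < 1 := by
    refine (continuous_seminorm N).continuousAt.eventually_lt continuousAt_const ?_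
    simp
  obtain ⟨r, hr, hb⟩ := Metric.eventually_nhds_iff.1 h
  exact ⟨r, hr, fun x hx => (hb (by simpa using hx)).le⟩

/-- The integrand of the Lévy–Khintchine formula. -/
def levyKhintchineIntegrand (N : Seminorm ℝ (Vec d)) (u x : Vec d) : ℂ :=
  Complex.exp (Complex.I * (inner ℝ u x : ℝ)) - 1
    - Set.indicator {x : Vec d | N x ≤ 1} (fun x => Complex.I * ((inner ℝ u x : ℝ) : ℂ)) x

lemma measurable_levyKhintchineIntegrand (u : Vec d) :
    Measurable (levyKhintchineIntegrand N u) := by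
  unfold levyKhintchineIntegrand
  refine Measurable.sub (by fun_prop) (Measurable.indicator (by fun_prop) ?_)
  exact measurableSet_le (continuous_seminorm N).measurable measurable_const

lemma norm_exp_sub_one_sub_le (z : ℝ) :
    ‖Complex.exp (Complex.I * z) - 1 - Complex.I * z‖ ≤ 2 * z ^ 2 := by
  rcases le_or_gt |z| 1 with h | h
  · have h1 : ‖Complex.I * (z : ℂ)‖ ≤ 1 := by simpa using h
    refine (Complex.norm_exp_sub_one_sub_id_le h1).trans ?_
    have : ‖Complex.I * (z : ℂ)‖ = |z| := by simp
    rw [this, sq_abs]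
    nlinarith [sq_nonneg z]
  · refine (norm_sub_le _ _).trans ?_
    have h1 : ‖Complex.exp (Complex.I * z) - 1‖ ≤ |z| := Real.norm_exp_I_mul_ofReal_sub_one_le
    have h2 : ‖Complex.I * (z : ℂ)‖ = |z| := by simp
    rw [h2, ← sq_abs]
    nlinarith

/-- The bound is locally uniform in `u`, so it yields both integrability and, by domination,
continuity in `u`. -/
lemma exists_norm_levyKhintchineIntegrand_le (hN : ∀ x, N x = 0 → x = 0) :
    ∃ K : ℝ, 0 ≤ K ∧ ∀ u x, ‖levyKhintchineIntegrand N u x‖ ≤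
      K * (1 + ‖u‖ ^ 2) * min 1 (‖x‖ ^ 2) := by
  obtain ⟨R, hR, hR'⟩ := exists_norm_le_of_seminorm_le_one hN
  obtain ⟨r, hr, hr'⟩ := exists_seminorm_le_one_of_norm_lt N
  -- The first summand serves `N x ≤ 1`, where `‖x‖ ≤ R` and the integrand is quadratic; the second
  -- serves `N x > 1`, where `‖x‖ ≥ r` and the integrand is at most `2`.
  refine ⟨2 * R ^ 2 + 2 * (1 + (r ^ 2)⁻¹), by positivity, fun u x => ?_⟩
  have hm0 : 0 ≤ min 1 (‖x‖ ^ 2) := le_min zero_le_one (sq_nonneg _)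
  have hu0 := sq_nonneg ‖u‖
  by_cases hx : N x ≤ 1
  · have : levyKhintchineIntegrand N u x =
        Complex.exp (Complex.I * (inner ℝ u x : ℝ)) - 1 - Complex.I * (inner ℝ u x : ℝ) := by
      rw [levyKhintchineIntegrand, Set.indicator_of_mem (by exact hx)]
    rw [this]
    have hx2 : ‖x‖ ^ 2 ≤ R ^ 2 * min 1 (‖x‖ ^ 2) := by
      rcases min_choice 1 (‖x‖ ^ 2) with h | h <;> rw [h]
      · rw [mul_one]
        exact pow_le_pow_left₀ (norm_nonneg _) (hR' x hx) 2
      · exact le_mul_of_one_le_left (sq_nonneg _) (one_le_pow₀ hR)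
    calc _ ≤ 2 * (inner ℝ u x : ℝ) ^ 2 := norm_exp_sub_one_sub_le _
      _ ≤ 2 * (‖u‖ * ‖x‖) ^ 2 := by
        have := pow_le_pow_left₀ (abs_nonneg _) (abs_real_inner_le_norm u x) 2
        rw [sq_abs] at this
        linarith
      _ = 2 * (‖u‖ ^ 2 * ‖x‖ ^ 2) := by ring
      _ ≤ 2 * (‖u‖ ^ 2 * (R ^ 2 * min 1 (‖x‖ ^ 2))) := by gcongr
      _ = 2 * R ^ 2 * ‖u‖ ^ 2 * min 1 (‖x‖ ^ 2) := by ring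
      _ ≤ _ := by
        gcongr
        · have : 0 ≤ (r ^ 2)⁻¹ := by positivity
          linarith
        · linarith
  · have : levyKhintchineIntegrand N u x =
        Complex.exp (Complex.I * (inner ℝ u x : ℝ)) - 1 := by
      rw [levyKhintchineIntegrand, Set.indicator_of_notMem (by exact hx), sub_zero]
    rw [this]
    have hxr : r ≤ ‖x‖ := by
      by_contra! h
      exact hx (hr' x h)
    have hx2 : 1 ≤ (1 + (r ^ 2)⁻¹) * min 1 (‖x‖ ^ 2) := by
      have hi : 0 < (r ^ 2)⁻¹ := by positivity
      have hrx : r ^ 2 ≤ ‖x‖ ^ 2 := pow_le_pow_left₀ hr.le hxr 2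
      rcases min_choice 1 (‖x‖ ^ 2) with h | h <;> rw [h]
      · linarith
      · have : (r ^ 2)⁻¹ * r ^ 2 = 1 := inv_mul_cancel₀ (by positivity)
        nlinarith [sq_nonneg ‖x‖]
    have h2 : ‖Complex.exp (Complex.I * (inner ℝ u x : ℝ)) - 1‖ ≤ 2 := by
      refine (norm_sub_le _ _).trans ?_
      rw [mul_comm, Complex.norm_exp_ofReal_mul_I, norm_one]
      norm_num
    calc _ ≤ (2 : ℝ) := h2
      _ ≤ 2 * ((1 + (r ^ 2)⁻¹) * min 1 (‖x‖ ^ 2)) := by linarith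
      _ = 2 * (1 + (r ^ 2)⁻¹) * 1 * min 1 (‖x‖ ^ 2) := by ring
      _ ≤ _ := by
        gcongr
        · have : 0 ≤ R ^ 2 := by positivity
          linarith
        · linarith

lemma IsLevyMeasure.integrable_min (h : IsLevyMeasure Λ) :
    Integrable (fun x : Vec d => min 1 (‖x‖ ^ 2)) Λ := by
  refine ⟨by fun_prop, ?_⟩
  rw [hasFiniteIntegral_iff_ofReal]
  · exact h.integrability
  · exact ae_of_all _ fun x => le_min zero_le_one (sq_nonneg _)

lemma integrable_levyKhintchineIntegrand (hN : ∀ x, N x = 0 → x = 0) (h : IsLevyMeasure Λ)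
    (u : Vec d) : Integrable (levyKhintchineIntegrand N u) Λ := by
  obtain ⟨K, -, hK⟩ := exists_norm_levyKhintchineIntegrand_le hN
  exact (h.integrable_min.const_mul (K * (1 + ‖u‖ ^ 2))).mono'
    (measurable_levyKhintchineIntegrand u).aestronglyMeasurable (ae_of_all _ (hK u))

lemma continuous_integral_levyKhintchineIntegrand (hN : ∀ x, N x = 0 → x = 0)
    (h : IsLevyMeasure Λ) : Continuous fun u => ∫ x, levyKhintchineIntegrand N u x ∂Λ := by
  obtain ⟨K, hK0, hK⟩ := exists_norm_levyKhintchineIntegrand_le hN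
  rw [continuous_iff_continuousAt]
  intro u₀
  refine continuousAt_of_dominated (bound := fun x =>
    K * (1 + (‖u₀‖ + 1) ^ 2) * min 1 (‖x‖ ^ 2)) ?_ ?_ (h.integrable_min.const_mul _) ?_
  · exact Eventually.of_forall fun u => (measurable_levyKhintchineIntegrand u).aestronglyMeasurable
  · filter_upwards [Metric.ball_mem_nhds u₀ one_pos] with u hu
    refine ae_of_all _ fun x => (hK u x).trans ?_
    have hu' : ‖u‖ ≤ ‖u₀‖ + 1 := by
      have h1 := norm_sub_norm_le u u₀
      rw [mem_ball_iff_norm] at hu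
      linarith
    have hm0 : 0 ≤ min 1 (‖x‖ ^ 2) := le_min zero_le_one (sq_nonneg _)
    gcongr
  · refine ae_of_all _ fun x => Continuous.continuousAt ?_
    unfold levyKhintchineIntegrand
    by_cases hx : N x ≤ 1
    · have : ∀ u : Vec d, Set.indicator {x : Vec d | N x ≤ 1}
          (fun x => Complex.I * ((inner ℝ u x : ℝ) : ℂ)) x = Complex.I * (inner ℝ u x : ℝ) :=
        fun u => Set.indicator_of_mem (by exact hx) _
      simp only [this]
      fun_prop
    · have : ∀ u : Vec d, Set.indicator {x : Vec d | N x ≤ 1}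
          (fun x => Complex.I * ((inner ℝ u x : ℝ) : ℂ)) x = 0 :=
        fun u => Set.indicator_of_notMem (by exact hx) _
      simp only [this]
      fun_prop

lemma levyKhintchineExponent_zero_zero (u : Vec d) :
    levyKhintchineExponent N 0 0 Λ u = ∫ x, levyKhintchineIntegrand N u x ∂Λ := by
  simp [levyKhintchineExponent, levyKhintchineIntegrand]

/-- The change of the compensated set under a scaling. -/
def compensatorShift (N : Seminorm ℝ (Vec d)) (α : Fin d → ℝ) (t : ℝ) (x : Vec d) : ℝ :=
  Set.indicator {x : Vec d | N x ≤ 1} 1 (scaling α t x) - Set.indicator {x : Vec d | N x ≤ 1} 1 x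

/-- The scaling is self-adjoint, so the exponentials agree and only the truncation differs. -/
lemma levyKhintchineIntegrand_scaling (α : Fin d → ℝ) (t : ℝ) (u x : Vec d) :
    levyKhintchineIntegrand N (scaling α t u) x = levyKhintchineIntegrand N u (scaling α t x)
      + Complex.I * ((compensatorShift N α t x * inner ℝ u (scaling α t x) : ℝ) : ℂ) := by
  simp only [levyKhintchineIntegrand, compensatorShift, inner_scaling, Set.indicator_apply,
    Pi.one_apply]
  split_ifs <;> push_cast <;> ring

namespace IsHeteroStableMeasure

variable {Λs : Measure (Vec d)} {α cp cm : Fin d → ℝ}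

lemma integrable_comp_scaling (h : IsHeteroStableMeasure Λs α cp cm Λ) {t : ℝ} (ht : 0 < t)
    {f : Vec d → ℂ} (hf : Integrable f Λ) : Integrable (fun x => f (scaling α t x)) Λ := by
  have : Integrable f (Λ.map (scaling α t)) := by
    rw [h.map_scaling ht]
    exact hf.smul_measure ENNReal.ofReal_ne_top
  exact this.comp_measurable (measurable_scaling α t)

lemma integral_comp_scaling (h : IsHeteroStableMeasure Λs α cp cm Λ) {t : ℝ} (ht : 0 < t)
    {f : Vec d → ℂ} (hf : Measurable f) :
    ∫ x, f (scaling α t x) ∂Λ = (t : ℂ) * ∫ x, f x ∂Λ := by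
  rw [← integral_map (measurable_scaling α t).aemeasurable hf.aestronglyMeasurable,
    h.map_scaling ht, integral_smul_measure, ENNReal.toReal_ofReal ht.le, Complex.real_smul]

/-- No estimate is needed: up to the factor `i`, the function is a difference of two integrable
integrands. -/
lemma integrable_compensatorShift (h : IsHeteroStableMeasure Λs α cp cm Λ)
    (hN : ∀ x, N x = 0 → x = 0) {t : ℝ} (ht : 0 < t) (u : Vec d) :
    Integrable (fun x => compensatorShift N α t x * inner ℝ u (scaling α t x)) Λ := by
  have h1 := (integrable_levyKhintchineIntegrand hN h.isLevyMeasure (scaling α t u)).sub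
    (h.integrable_comp_scaling ht (integrable_levyKhintchineIntegrand hN h.isLevyMeasure u))
  have h2 := (h1.const_mul (-Complex.I)).re
  refine h2.congr (ae_of_all _ fun x => ?_)
  simp only [Pi.sub_apply, levyKhintchineIntegrand_scaling, add_sub_cancel_left, ← mul_assoc,
    neg_mul, Complex.I_mul_I, neg_neg, one_mul]
  rfl

/-- The drift picked up by the Lévy–Khintchine integral under a scaling. -/
lemma exists_integral_levyKhintchineIntegrand_scaling
    (h : IsHeteroStableMeasure Λs α cp cm Λ) (hN : ∀ x, N x = 0 → x = 0) {t : ℝ} (ht : 0 < t) :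
    ∃ γ : Vec d, ∀ u, (t : ℂ) * ∫ x, levyKhintchineIntegrand N u x ∂Λ =
      ∫ x, levyKhintchineIntegrand N (scaling α t u) x ∂Λ
        + Complex.I * ((inner ℝ u γ : ℝ) : ℂ) := by
  have hcoord : ∀ i, Integrable (fun x => compensatorShift N α t x * scaling α t x i) Λ := by
    intro i
    simpa [EuclideanSpace.inner_single_left] using
      h.integrable_compensatorShift hN ht (EuclideanSpace.single i 1)
  refine ⟨WithLp.toLp 2 fun i => -∫ x, compensatorShift N α t x * scaling α t x i ∂Λ, fun u => ?_⟩
  have hsum : ∫ x, compensatorShift N α t x * inner ℝ u (scaling α t x) ∂Λ =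
      ∑ i, u i * ∫ x, compensatorShift N α t x * scaling α t x i ∂Λ := by
    simp_rw [← integral_const_mul]
    rw [← integral_finsetSum _ fun i _ => (hcoord i).const_mul _]
    refine integral_congr_ae (ae_of_all _ fun x => ?_)
    simp only [PiLp.inner_apply, RCLike.inner_apply, conj_trivial, Finset.mul_sum]
    exact Finset.sum_congr rfl fun i _ => by ring
  have hint : Integrable (fun x =>
      ((compensatorShift N α t x * inner ℝ u (scaling α t x) : ℝ) : ℂ)) Λ :=
    (h.integrable_compensatorShift hN ht u).ofReal
  have hinner : inner ℝ u (WithLp.toLp 2 fun i =>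
      -∫ x, compensatorShift N α t x * scaling α t x i ∂Λ) =
      -∫ x, compensatorShift N α t x * inner ℝ u (scaling α t x) ∂Λ := by
    rw [hsum]
    simp only [PiLp.inner_apply, RCLike.inner_apply, conj_trivial, ← Finset.sum_neg_distrib]
    exact Finset.sum_congr rfl fun i _ => by ring
  rw [hinner]
  simp_rw [levyKhintchineIntegrand_scaling]
  rw [integral_add (h.integrable_comp_scaling ht
    (integrable_levyKhintchineIntegrand hN h.isLevyMeasure u)) (hint.const_mul _),
    h.integral_comp_scaling ht (measurable_levyKhintchineIntegrand u), integral_const_mul]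
  have : ∫ x, ((compensatorShift N α t x * inner ℝ u (scaling α t x) : ℝ) : ℂ) ∂Λ =
      ((∫ x, compensatorShift N α t x * inner ℝ u (scaling α t x) ∂Λ : ℝ) : ℂ) := integral_ofReal
  rw [this]
  push_cast
  ring

end IsHeteroStableMeasure

end

/-! ### Laws of a Lévy process at all times. -/

section

variable {d : ℕ}

/-- A continuous `n`-th root of `exp ∘ g` with value `1` at the origin is `exp ∘ (g / n)`. -/
lemma eq_exp_div_of_pow_eq_exp {E : Type*} [TopologicalSpace E] [PreconnectedSpace E] [Zero E]
    {f g : E → ℂ} (hf : Continuous f) (hg : Continuous g) (hf0 : f 0 = 1) (hg0 : g 0 = 0) {n : ℕ}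
    (hn : n ≠ 0) (h : ∀ u, f u ^ n = Complex.exp (g u)) (u : E) :
    f u = Complex.exp (g u / n) := by
  -- The quotient `q` of the two roots is continuous with values in the `n`-th roots of unity, a
  -- finite set, so it is constant on a connected space.
  set q : E → ℂ := fun u => f u * Complex.exp (-(g u / n)) with hq
  have hn' : (n : ℂ) ≠ 0 := by exact_mod_cast hn
  have hqc : Continuous q := by fun_prop
  have hqn : ∀ u, q u ^ n = 1 := by
    intro u
    rw [hq]
    simp only [mul_pow, h, ← Complex.exp_nat_mul, ← Complex.exp_add]
    rw [mul_neg, mul_div_cancel₀ _ hn', add_neg_cancel, Complex.exp_zero]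
  have hfin : {z : ℂ | z ^ n = 1}.Finite := by
    refine (Polynomial.nthRoots n (1 : ℂ)).toFinset.finite_toSet.subset fun z hz => ?_
    simpa [Polynomial.mem_nthRoots (Nat.pos_of_ne_zero hn)] using hz
  have hsub : (Set.range q).Subsingleton :=
    hfin.countable.isTotallyDisconnected _ (by rintro _ ⟨u, rfl⟩; exact hqn u)
      (isPreconnected_range hqc)
  have h1 : q u = 1 := by
    rw [hsub ⟨u, rfl⟩ ⟨0, rfl⟩, hq]
    simp [hf0, hg0]
  rw [hq] at h1
  simp only [Complex.exp_neg] at h1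
  rwa [← div_eq_mul_inv, div_eq_one_iff_eq (Complex.exp_ne_zero _)] at h1

namespace IsLevyProcess

variable {Ω : Type*} [MeasurableSpace Ω] {P : Measure Ω} {X : ℝ≥0 → Ω → Vec d}

lemma map_increment (h : IsLevyProcess X P) (s t : ℝ≥0) :
    P.map (fun ω => X (t + s) ω - X s ω) = P.map (X t) := by
  rw [h.stationary_increments s t]
  refine Measure.map_congr ?_
  filter_upwards [h.zero] with ω hω
  rw [hω, sub_zero]

variable [IsProbabilityMeasure P]

lemma charFun_add (h : IsLevyProcess X P) (s t : ℝ≥0) (u : Vec d) :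
    charFun (P.map (X (t + s))) u = charFun (P.map (X s)) u * charFun (P.map (X t)) u := by
  have hind : IndepFun (X s) (X (t + s) - X s) P :=
    h.indep_increments.indepFun_eval_sub zero_le le_add_self h.zero
  have := hind.charFun_map_add_eq_mul (h.measurable s).aemeasurable
    ((h.measurable (t + s)).sub (h.measurable s)).aemeasurable
  rw [add_sub_cancel] at this
  rw [this, Pi.mul_apply, ← h.map_increment s t]
  rfl

lemma charFun_zero (h : IsLevyProcess X P) (u : Vec d) : charFun (P.map (X 0)) u = 1 := by
  rw [Measure.map_congr h.zero, charFun_apply, integral_map (by fun_prop) (by fun_prop)]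
  simp

lemma charFun_nsmul (h : IsLevyProcess X P) (n : ℕ) (t : ℝ≥0) (u : Vec d) :
    charFun (P.map (X (n • t))) u = charFun (P.map (X t)) u ^ n := by
  induction n with
  | zero => simpa using h.charFun_zero u
  | succ n ih => rw [succ_nsmul, h.charFun_add, ih, pow_succ, mul_comm]

lemma tendsto_charFun (h : IsLevyProcess X P) {t : ℝ≥0} {r : ℕ → ℝ≥0} (hr : ∀ k, t ≤ r k)
    (hlim : Tendsto r atTop (𝓝 t)) (u : Vec d) :
    Tendsto (fun k => charFun (P.map (X (r k))) u) atTop (𝓝 (charFun (P.map (X t)) u)) := by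
  have key : ∀ s, charFun (P.map (X s)) u =
      ∫ ω, Complex.exp ((inner ℝ (X s ω) u : ℝ) * Complex.I) ∂P := fun s => by
    rw [charFun_apply, integral_map (h.measurable s).aemeasurable (by fun_prop)]
  simp only [key]
  refine tendsto_integral_of_dominated_convergence (fun _ => 1) ?_ (integrable_const 1) ?_ ?_
  · intro k
    have := h.measurable (r k)
    fun_prop
  · exact fun k => ae_of_all _ fun ω => (Complex.norm_exp_ofReal_mul_I _).le
  · filter_upwards [h.cadlag] with ω hω
    have h1 : Tendsto (fun k => X (r k) ω) atTop (𝓝 (X t ω)) :=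
      (hω t).1.tendsto.comp (tendsto_nhdsWithin_iff.2 ⟨hlim, Eventually.of_forall hr⟩)
    have h2 : Continuous fun x : Vec d => Complex.exp ((inner ℝ x u : ℝ) * Complex.I) := by fun_prop
    exact (h2.tendsto _).comp h1

/-- If the law at time one has continuous exponent `ψ`, then the law at time `t` has exponent
`t ψ`. -/
theorem charFun_eq_exp (h : IsLevyProcess X P) {ψ : Vec d → ℂ} (hψ : Continuous ψ) (hψ0 : ψ 0 = 0)
    (h1 : ∀ u, charFun (P.map (X 1)) u = Complex.exp (ψ u)) (t : ℝ≥0) (u : Vec d) :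
    charFun (P.map (X t)) u = Complex.exp ((t : ℂ) * ψ u) := by
  have hprob : ∀ s, IsProbabilityMeasure (P.map (X s)) := fun s =>
    Measure.isProbabilityMeasure_map (h.measurable s).aemeasurable
  have hroot : ∀ k : ℕ, charFun (P.map (X ((k + 1 : ℕ) : ℝ≥0)⁻¹)) u =
      Complex.exp (ψ u / ((k + 1 : ℕ) : ℂ)) := by
    intro k
    refine eq_exp_div_of_pow_eq_exp continuous_charFun hψ (by simp) hψ0 k.succ_ne_zero
      (fun v => ?_) u
    rw [← h.charFun_nsmul, nsmul_eq_mul, mul_inv_cancel₀ (by positivity), h1]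
  -- Rational times approach `t` from above, hence the `+ 1`: paths are only right-continuous.
  set r : ℕ → ℝ≥0 := fun k => (⌊t * (k + 1 : ℕ)⌋₊ + 1) • ((k + 1 : ℕ) : ℝ≥0)⁻¹ with hr
  have hrv : ∀ k, r k = ((⌊t * (k + 1 : ℕ)⌋₊ + 1 : ℕ) : ℝ≥0) / ((k + 1 : ℕ) : ℝ≥0) := fun k => by
    simp only [hr, nsmul_eq_mul, div_eq_mul_inv]
  have hge : ∀ k, t ≤ r k := by
    intro k
    rw [hrv, le_div_iff₀ (by positivity)]
    exact_mod_cast (Nat.lt_floor_add_one _).le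
  have hle : ∀ k, r k ≤ t + 1 / ((k : ℝ≥0) + 1) := by
    intro k
    have hpos : (0 : ℝ≥0) < (k : ℝ≥0) + 1 := by positivity
    rw [hrv, div_le_iff₀ (by positivity)]
    push_cast
    rw [add_mul, one_div_mul_cancel hpos.ne']
    gcongr
    exact Nat.floor_le (by positivity)
  have hlim : Tendsto r atTop (𝓝 t) := by
    refine tendsto_of_tendsto_of_tendsto_of_le_of_le tendsto_const_nhds ?_ hge hle
    simpa using tendsto_const_nhds.add (tendsto_one_div_add_atTop_nhds_zero_nat (𝕜 := ℝ≥0))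
  have hval : ∀ k, charFun (P.map (X (r k))) u = Complex.exp ((r k : ℂ) * ψ u) := by
    intro k
    rw [hrv, div_eq_mul_inv, ← nsmul_eq_mul, h.charFun_nsmul, hroot, ← Complex.exp_nat_mul]
    congr 1
    rw [nsmul_eq_mul]
    push_cast
    ring
  refine tendsto_nhds_unique (h.tendsto_charFun hge hlim u) ?_
  simp only [hval]
  have hc : Continuous fun s : ℝ≥0 => Complex.exp ((s : ℂ) * ψ u) := by
    have : Continuous fun s : ℝ≥0 => ((s : ℝ) : ℂ) := by fun_prop
    fun_prop
  exact (hc.tendsto t).comp hlim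

end IsLevyProcess

namespace IsHeteroStableProcess

variable {Ω : Type*} [MeasurableSpace Ω] {P : Measure Ω} [IsProbabilityMeasure P]
  {N : Seminorm ℝ (Vec d)} {Λs Λ : Measure (Vec d)} {α cp cm : Fin d → ℝ} {X : ℝ≥0 → Ω → Vec d}

lemma charFun_eq (hX : IsHeteroStableProcess N Λs α cp cm Λ X P) (hN : ∀ x, N x = 0 → x = 0)
    (t : ℝ≥0) (u : Vec d) : charFun (P.map (X t)) u =
      Complex.exp ((t : ℂ) * ∫ x, levyKhintchineIntegrand N u x ∂Λ) := by
  refine hX.isLevyProcess.charFun_eq_exp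
    (continuous_integral_levyKhintchineIntegrand hN hX.measure.isLevyMeasure) ?_ (fun v => ?_) t u
  · simp [levyKhintchineIntegrand]
  · rw [hX.triplet.charFun_eq, levyKhintchineExponent_zero_zero]

lemma exists_map_eq (hX : IsHeteroStableProcess N Λs α cp cm Λ X P) (hN : ∀ x, N x = 0 → x = 0)
    (t : ℝ≥0) : ∃ γ : Vec d, P.map (X t) = P.map (fun ω => scaling α t (X 1 ω) + γ) := by
  have hm := hX.isLevyProcess.measurable
  have hprob : ∀ s, IsProbabilityMeasure (P.map (X s)) := fun s =>
    Measure.isProbabilityMeasure_map (hm s).aemeasurable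
  rcases eq_or_ne t 0 with rfl | ht
  -- At `t = 0` the scaling is zero, since `0 ^ (1 / α i) = 0`, and `X 0 = 0` almost surely.
  · refine ⟨0, Measure.map_congr ?_⟩
    filter_upwards [hX.isLevyProcess.zero] with ω hω
    rw [hω]
    ext i
    have := hX.measure.index_pos i
    simp [Real.zero_rpow (inv_ne_zero this.ne')]
  · have ht' : (0 : ℝ) < t := by exact_mod_cast pos_iff_ne_zero.2 ht
    obtain ⟨γ, hγ⟩ := hX.measure.exists_integral_levyKhintchineIntegrand_scaling hN ht'
    refine ⟨γ, ?_⟩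
    have hm1 : Measurable fun ω => scaling α t (X 1 ω) + γ :=
      ((measurable_scaling α t).comp (hm 1)).add_const γ
    have := Measure.isProbabilityMeasure_map (μ := P) hm1.aemeasurable
    refine Measure.ext_of_charFun (funext fun u => ?_)
    have h1 : charFun (P.map fun ω => scaling α t (X 1 ω) + γ) u =
        charFun (P.map (X 1)) (scaling α t u) * Complex.exp ((inner ℝ γ u : ℝ) * Complex.I) := by
      rw [charFun_apply, charFun_apply, integral_map hm1.aemeasurable (by fun_prop),
        integral_map (hm 1).aemeasurable (by fun_prop), ← integral_mul_const]
      refine integral_congr_ae (ae_of_all _ fun ω => ?_)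
      simp only [inner_add_left, inner_scaling]
      rw [← Complex.exp_add]
      push_cast
      ring_nf
    rw [h1, hX.charFun_eq hN, hX.charFun_eq hN, ← Complex.exp_add, real_inner_comm]
    congr 1
    rw [hγ u]
    push_cast
    ring

end IsHeteroStableProcess

end

/-! ### Absence of atoms in the marginals. -/

section

variable {d : ℕ}

lemma tendsto_sinc_mul_atTop {x : ℝ} (hx : x ≠ 0) :
    Tendsto (fun n : ℕ => Real.sinc (((n : ℝ) + 1) * x)) atTop (𝓝 0) := by
  have hb : ∀ n : ℕ, |Real.sinc (((n : ℝ) + 1) * x)| ≤ 1 / ((n : ℝ) + 1) * |x|⁻¹ := by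
    intro n
    have hn : (0 : ℝ) < (n : ℝ) + 1 := by positivity
    rw [Real.sinc_of_ne_zero (mul_ne_zero hn.ne' hx), abs_div, abs_mul, abs_of_pos hn,
      one_div, ← mul_inv, div_eq_mul_inv]
    exact mul_le_of_le_one_left (by positivity) (Real.abs_sin_le_one _)
  refine squeeze_zero_norm hb ?_
  simpa using (tendsto_one_div_add_atTop_nhds_zero_nat (𝕜 := ℝ)).mul_const |x|⁻¹

/-- The mean of the characteristic function over growing symmetric intervals tends to the mass of the
origin. -/
lemma tendsto_integral_charFun_mul (μ : Measure ℝ) [IsFiniteMeasure μ] :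
    Tendsto (fun n : ℕ => ∫ s in (-1 : ℝ)..1, charFun μ (((n : ℝ) + 1) * s)) atTop
      (𝓝 (2 * (μ.real {0} : ℂ))) := by
  have hval : ∀ n : ℕ, ∫ s in (-1 : ℝ)..1, charFun μ (((n : ℝ) + 1) * s) =
      2 * ((∫ x, Real.sinc (((n : ℝ) + 1) * x) ∂μ : ℝ) : ℂ) := by
    intro n
    have hn : (0 : ℝ) < (n : ℝ) + 1 := by positivity
    have hn' : ((n : ℂ) + 1) ≠ 0 := by exact_mod_cast hn.ne'
    -- Averaging `e^{isx}` over a symmetric interval gives a sinc, which tends to the indicator of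
    -- `x = 0` as the interval grows.
    rw [intervalIntegral.integral_comp_mul_left (fun s => charFun μ s) hn.ne', mul_neg_one, mul_one,
      integral_charFun_Icc hn, Complex.real_smul]
    push_cast
    field_simp
  simp only [hval]
  refine Tendsto.const_mul _ ((Complex.continuous_ofReal.tendsto _).comp ?_)
  have h0 : μ.real {0} = ∫ x, Set.indicator {0} (fun _ => (1 : ℝ)) x ∂μ := by
    rw [integral_indicator_const _ (measurableSet_singleton 0)]
    simp
  rw [h0]
  refine tendsto_integral_of_dominated_convergence (fun _ => 1) ?_ (integrable_const 1) ?_ ?_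
  · intro n
    exact (Real.continuous_sinc.comp (continuous_const.mul continuous_id)).aestronglyMeasurable
  · exact fun n => ae_of_all _ fun x => Real.abs_sinc_le_one _
  · refine ae_of_all _ fun x => ?_
    rcases eq_or_ne x 0 with rfl | hx
    · simp
    · simpa [hx] using tendsto_sinc_mul_atTop hx

lemma measure_singleton_zero_of_tendsto_charFun (μ : Measure ℝ) [IsFiniteMeasure μ]
    (h : Tendsto (fun r => ‖charFun μ r‖) atTop (𝓝 0)) : μ {0} = 0 := by
  have hlim : Tendsto (fun n : ℕ => ∫ s in (-1 : ℝ)..1, charFun μ (((n : ℝ) + 1) * s)) atTop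
      (𝓝 (∫ _ in (-1 : ℝ)..1, (0 : ℂ))) := by
    refine intervalIntegral.tendsto_integral_filter_of_dominated_convergence
      (fun _ => μ.real Set.univ) ?_ ?_ intervalIntegrable_const ?_
    · exact Eventually.of_forall fun n =>
        (measurable_charFun.comp (measurable_const.mul measurable_id)).aestronglyMeasurable
    · exact Eventually.of_forall fun n => ae_of_all _ fun s _ => norm_charFun_le _
    · have h0 : ∀ᵐ s : ℝ, s ≠ 0 := by simp [ae_iff]
      filter_upwards [h0] with s hs _
      rw [tendsto_zero_iff_norm_tendsto_zero]
      -- Decay is assumed only at `+∞`; conjugation symmetry covers negative `s`.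
      have heven : ∀ r, ‖charFun μ r‖ = ‖charFun μ |r|‖ := by
        intro r
        rcases abs_choice r with h | h <;> rw [h]
        rw [charFun_neg, RCLike.norm_conj]
      have hmul : Tendsto (fun n : ℕ => ((n : ℝ) + 1) * |s|) atTop atTop :=
        (tendsto_atTop_add_const_right _ _ tendsto_natCast_atTop_atTop).atTop_mul_const
          (abs_pos.2 hs)
      refine (h.comp hmul).congr fun n => ?_
      rw [Function.comp_apply, heven (((n : ℝ) + 1) * s), abs_mul,
        abs_of_pos (by positivity : (0 : ℝ) < (n : ℝ) + 1)]
  have := tendsto_nhds_unique (tendsto_integral_charFun_mul μ) hlim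
  simpa [measureReal_def, ENNReal.toReal_eq_zero_iff] using this

/-- A finite measure whose characteristic function vanishes at infinity has no atoms. -/
theorem noAtoms_of_tendsto_charFun (μ : Measure ℝ) [IsFiniteMeasure μ]
    (h : Tendsto (fun r => ‖charFun μ r‖) atTop (𝓝 0)) : NullSingletonClass μ := by
  refine ⟨fun a => ?_⟩
  -- Translating an atom to the origin changes the characteristic function by a unimodular factor
  -- only.
  have h0 := measure_singleton_zero_of_tendsto_charFun (μ.map (· + -a)) ?_
  · rw [Measure.map_apply (by fun_prop) (measurableSet_singleton 0)] at h0
    refine measure_mono_null ?_ h0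
    rintro x rfl
    simp
  · simpa only [charFun_map_add_const, norm_mul, Complex.norm_exp_ofReal_mul_I, mul_one] using h

namespace IsHeteroStableMeasure

variable {N : Seminorm ℝ (Vec d)} {Λs Λ : Measure (Vec d)} {α cp cm : Fin d → ℝ}

/-- Otherwise the strip `1/2 ≤ x i < 1`, on which `cos < 1`, would be null, whereas the stable tail
strictly decreases from `1/2` to `1`. -/
lemma not_ae_cos_eq_one (h : IsHeteroStableMeasure Λs α cp cm Λ) (i : Fin d) :
    ¬ ∀ᵐ x ∂Λ, Real.cos (x i) = 1 := by
  intro hcos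
  have hset : tailFunction Λ i (1 / 2) = tailFunction Λ i 1 := by
    rw [tailFunction, tailFunction, if_pos (by norm_num), if_pos (by norm_num)]
    refine measure_congr ?_
    filter_upwards [hcos] with x hx
    refine propext ⟨fun hx1 => ⟨?_, hx1.2⟩, fun hx1 => ⟨le_trans (by norm_num) hx1.1, hx1.2⟩⟩
    by_contra! hlt
    have h12 : 1 / 2 ≤ x i := hx1.1
    have := Real.cos_lt_cos_of_nonneg_of_le_pi le_rfl (by linarith [Real.pi_gt_three])
      (by linarith : (0 : ℝ) < x i)
    rw [Real.cos_zero, hx] at this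
    exact lt_irrefl _ this
  rw [h.tail_eq, h.tail_eq, ← inv_inj, inv_stableTail (h.cp_pos i) (h.cm_pos i) (h.index_pos i),
    inv_stableTail (h.cp_pos i) (h.cm_pos i) (h.index_pos i), if_pos (by norm_num),
    if_pos (by norm_num)] at hset
  have hc := h.cp_pos i
  rw [ENNReal.ofReal_eq_ofReal_iff (by positivity) (by positivity), div_left_inj' hc.ne', abs_one,
    Real.one_rpow] at hset
  have := Real.rpow_lt_one (abs_nonneg (1 / 2 : ℝ)) (by norm_num [abs_of_pos]) (h.index_pos i)
  exact this.ne hset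

/-- The compensator is purely imaginary, so the real part is `∫ (cos (x i) - 1) ∂Λ`. -/
lemma re_integral_levyKhintchineIntegrand_neg (h : IsHeteroStableMeasure Λs α cp cm Λ)
    (hN : ∀ x, N x = 0 → x = 0) (i : Fin d) :
    (∫ x, levyKhintchineIntegrand N (EuclideanSpace.single i 1) x ∂Λ).re < 0 := by
  have hint := integrable_levyKhintchineIntegrand hN h.isLevyMeasure (EuclideanSpace.single i 1)
  have hre : ∀ x, (levyKhintchineIntegrand N (EuclideanSpace.single i 1) x).re =
      Real.cos (x i) - 1 := by
    intro x
    simp only [levyKhintchineIntegrand, Set.indicator_apply, EuclideanSpace.inner_single_left]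
    rw [mul_comm Complex.I]
    split_ifs <;> simp [Complex.exp_ofReal_mul_I_re]
  have hre' : (∫ x, levyKhintchineIntegrand N (EuclideanSpace.single i 1) x ∂Λ).re =
      ∫ x, (levyKhintchineIntegrand N (EuclideanSpace.single i 1) x).re ∂Λ :=
    (integral_re hint).symm
  have hint' : Integrable (fun x : Vec d => 1 - Real.cos (x i)) Λ := by
    refine hint.re.neg.congr (ae_of_all _ fun x => ?_)
    change -(levyKhintchineIntegrand N (EuclideanSpace.single i 1) x).re = _
    rw [hre, neg_sub]
  have hnn : ∀ x : Vec d, 0 ≤ 1 - Real.cos (x i) := fun x => by linarith [Real.cos_le_one (x i)]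
  have hpos : 0 < ∫ x : Vec d, (1 - Real.cos (x i)) ∂Λ := by
    refine lt_of_le_of_ne (integral_nonneg hnn) fun h0 => h.not_ae_cos_eq_one i ?_
    filter_upwards [(integral_eq_zero_iff_of_nonneg hnn hint').1 h0.symm] with x hx
    have : 1 - Real.cos (x i) = 0 := hx
    linarith
  rw [hre', ← neg_pos, ← integral_neg]
  simpa only [hre, neg_sub] using hpos

end IsHeteroStableMeasure

namespace IsHeteroStableProcess

variable {Ω : Type*} [MeasurableSpace Ω] {P : Measure Ω} [IsProbabilityMeasure P]
  {N : Seminorm ℝ (Vec d)} {Λs Λ : Measure (Vec d)} {α cp cm : Fin d → ℝ} {X : ℝ≥0 → Ω → Vec d}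

/-- The one-dimensional marginals of a heterogeneous stable process at time one have no atoms. -/
lemma noAtoms_map_coord (hX : IsHeteroStableProcess N Λs α cp cm Λ X P)
    (hN : ∀ x, N x = 0 → x = 0) (i : Fin d) : NullSingletonClass (P.map fun ω => X 1 ω i) := by
  have hm := hX.isLevyProcess.measurable 1
  have hmi : Measurable fun ω => X 1 ω i := (measurable_coord i).comp hm
  have := Measure.isProbabilityMeasure_map (μ := P) hmi.aemeasurable
  refine noAtoms_of_tendsto_charFun _ ?_
  set e : Vec d := EuclideanSpace.single i 1 with he
  have hα := hX.measure.index_pos i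
  set ρ := (∫ x, levyKhintchineIntegrand N e x ∂Λ).re with hρ
  have hρneg : ρ < 0 := hX.measure.re_integral_levyKhintchineIntegrand_neg hN i
  -- For `t = r ^ α i` the scaling sends `e` to `r • e`; real parts in the scaling identity remove
  -- the drift.
  have key : ∀ r : ℝ, 0 < r → ‖charFun (P.map fun ω => X 1 ω i) r‖ = Real.exp (r ^ α i * ρ) := by
    intro r hr
    have ht : 0 < r ^ α i := Real.rpow_pos_of_pos hr _
    have hsc : scaling α (r ^ α i) e = r • e := by
      ext j
      rcases eq_or_ne j i with rfl | hj
      · rw [scaling_apply, ← Real.rpow_mul hr.le, mul_one_div_cancel hα.ne', Real.rpow_one]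
        rfl
      · simp [he, hj]
    have h1 : charFun (P.map fun ω => X 1 ω i) r = charFun (P.map (X 1)) (r • e) := by
      rw [charFun_apply, charFun_apply, integral_map hmi.aemeasurable (by fun_prop),
        integral_map hm.aemeasurable (by fun_prop)]
      refine integral_congr_ae (ae_of_all _ fun ω => ?_)
      simp [he, inner_smul_right, EuclideanSpace.inner_single_right]
    obtain ⟨γ, hγ⟩ := hX.measure.exists_integral_levyKhintchineIntegrand_scaling hN ht
    have h2 := congrArg Complex.re (hγ e)
    rw [hsc] at h2
    rw [h1, hX.charFun_eq hN, Complex.norm_exp]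
    congr 1
    simpa [Complex.re_ofReal_mul, eq_comm] using h2
  have hlim : Tendsto (fun r : ℝ => Real.exp (r ^ α i * ρ)) atTop (𝓝 0) :=
    Real.tendsto_exp_atBot.comp ((tendsto_rpow_atTop hα).atTop_mul_const_of_neg hρneg)
  refine hlim.congr' ?_
  filter_upwards [eventually_gt_atTop 0] with r hr
  exact (key r hr).symm

end IsHeteroStableProcess

end

/-! ### Copulas and Sklar's theorem for atomless marginals. -/

section

variable {d : ℕ}

section CDF

variable (μ : Measure ℝ) [IsProbabilityMeasure μ] [NullSingletonClass μ]

lemma continuous_cdf : Continuous (cdf μ) := by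
  refine continuous_iff_continuousAt.2 fun x => ?_
  rw [(monotone_cdf μ).continuousAt_iff_leftLim_eq_rightLim, (cdf μ).rightLim_eq]
  have h := (cdf μ).measure_singleton x
  rw [measure_cdf, measure_singleton, eq_comm, ENNReal.ofReal_eq_zero, sub_nonpos] at h
  exact le_antisymm ((monotone_cdf μ).leftLim_le le_rfl) h

lemma exists_cdf_eq {u : ℝ} (hu : u ∈ Set.Ioo (0 : ℝ) 1) : ∃ x, cdf μ x = u := by
  obtain ⟨a, ha⟩ := ((tendsto_cdf_atBot μ).eventually_lt_const hu.1).exists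
  obtain ⟨b, hb⟩ := ((tendsto_cdf_atTop μ).eventually_const_lt hu.2).exists
  exact mem_range_of_exists_le_of_exists_ge (continuous_cdf μ) ⟨a, ha.le⟩ ⟨b, hb.le⟩

/-- The probability integral transform. -/
theorem map_cdf_eq : μ.map (cdf μ) = volume.restrict (Set.Icc (0 : ℝ) 1) := by
  have hmeas : Measurable (cdf μ) := (monotone_cdf μ).measurable
  have := Measure.isProbabilityMeasure_map (μ := μ) hmeas.aemeasurable
  refine Measure.ext_of_Iic _ _ fun u => ?_
  rw [Measure.map_apply hmeas measurableSet_Iic, Measure.restrict_apply measurableSet_Iic]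
  rcases lt_or_ge u 0 with h0 | h0
  · have h1 : cdf μ ⁻¹' Set.Iic u = ∅ := by
      ext x
      simpa using h0.trans_le (cdf_nonneg μ x)
    have h2 : Set.Iic u ∩ Set.Icc (0 : ℝ) 1 = ∅ := by
      ext x
      simp only [Set.mem_inter_iff, Set.mem_Iic, Set.mem_Icc, Set.mem_empty_iff_false, iff_false]
      rintro ⟨h, h', -⟩
      linarith
    simp [h1, h2]
  rcases le_or_gt 1 u with h1 | h1
  · have h2 : cdf μ ⁻¹' Set.Iic u = Set.univ := by
      ext x
      simpa using (cdf_le_one μ x).trans h1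
    have h3 : Set.Iic u ∩ Set.Icc (0 : ℝ) 1 = Set.Icc 0 1 :=
      Set.inter_eq_right.2 fun x hx => hx.2.trans h1
    simp [h2, h3]
  have h3 : Set.Iic u ∩ Set.Icc (0 : ℝ) 1 = Set.Icc 0 u := by
    ext x
    simp only [Set.mem_inter_iff, Set.mem_Iic, Set.mem_Icc]
    exact ⟨fun h => ⟨h.2.1, h.1⟩, fun h => ⟨h.2, h.1, h.2.trans h1.le⟩⟩
  rw [h3, Real.volume_Icc, sub_zero, ← ofReal_measureReal]
  congr 1
  apply le_antisymm
  -- The value `u` may be `0` and not attained by the distribution function, so it is approached by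
  -- attained values `v > u`.
  · refine le_of_forall_gt_imp_ge_of_dense fun v hv => ?_
    rcases le_or_gt 1 v with hv1 | hv1
    · exact measureReal_le_one.trans hv1
    obtain ⟨x, hx⟩ := exists_cdf_eq μ ⟨h0.trans_lt hv, hv1⟩
    rw [← hx, cdf_eq_real]
    refine measureReal_mono fun y hy => ?_
    by_contra hxy
    have h4 := monotone_cdf μ (not_le.1 hxy).le
    have h5 : cdf μ y ≤ u := hy
    linarith
  · rcases h0.eq_or_lt with rfl | h0
    · exact measureReal_nonneg
    obtain ⟨x, hx⟩ := exists_cdf_eq μ ⟨h0, h1⟩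
    rw [← hx, cdf_eq_real]
    refine measureReal_mono fun y hy => ?_
    change cdf μ y ≤ μ.real (Set.Iic x)
    rw [← cdf_eq_real]
    exact monotone_cdf μ hy

end CDF

lemma measurableSet_forall_le (x : Fin d → ℝ) : MeasurableSet {y : Fin d → ℝ | ∀ i, y i ≤ x i} :=
  measurableSet_Iic (a := x)

/-- Copulas are continuous. -/
theorem IsCopula.continuous {C : (Fin d → unitInterval) → ℝ} (hC : IsCopula C) : Continuous C := by
  obtain ⟨μ, hμ, hmarg, hval⟩ := hC
  refine continuous_iff_continuousAt.2 fun u => ?_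
  -- Uniform marginals do not charge the hyperplanes `y i = u i`; off them the indicators are
  -- eventually constant as `v → u`.
  have hne : ∀ᵐ y ∂μ, ∀ i, y i ≠ (u i : ℝ) := by
    refine ae_all_iff.2 fun i => ?_
    have h0 : μ.map (fun y => y i) {(u i : ℝ)} = 0 := by
      rw [hmarg]
      exact measure_singleton _
    rw [Measure.map_apply (measurable_pi_apply i) (measurableSet_singleton _)] at h0
    rw [ae_iff]
    refine measure_mono_null (fun y hy => ?_) h0
    simpa using hy
  have hlim : Tendsto (fun v : Fin d → unitInterval => μ {y | ∀ i, y i ≤ v i}) (𝓝 u)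
      (𝓝 (μ {y | ∀ i, y i ≤ u i})) := by
    refine tendsto_measure_of_ae_tendsto_indicator_of_isFiniteMeasure (𝓝 u)
      (measurableSet_forall_le fun i => (u i : ℝ))
      (fun v => measurableSet_forall_le fun i => (v i : ℝ)) ?_
    filter_upwards [hne] with y hy
    have hev : ∀ i, ∀ᶠ v : Fin d → unitInterval in 𝓝 u, (y i ≤ v i ↔ y i ≤ u i) := by
      intro i
      have hc : Tendsto (fun v : Fin d → unitInterval => (v i : ℝ)) (𝓝 u) (𝓝 (u i : ℝ)) :=
        (continuous_subtype_val.comp (continuous_apply i)).tendsto u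
      rcases (hy i).lt_or_gt with h | h
      · filter_upwards [hc.eventually_const_lt h] with v hv
        exact iff_of_true hv.le h.le
      · filter_upwards [hc.eventually_lt_const h] with v hv
        exact iff_of_false hv.not_ge h.not_ge
    filter_upwards [eventually_all.2 hev] with v hv
    exact forall_congr' hv
  have := (ENNReal.tendsto_toReal (measure_ne_top μ _)).comp hlim
  have hC : C = fun v => μ.real {y | ∀ i, y i ≤ v i} := funext hval
  rw [hC]
  exact this

/-- The open cube is dense and copulas are continuous. This is needed because distribution functions
need not attain `0` or `1`. -/
lemma IsCopula.eq_of_eqOn_Ioo {C C' : (Fin d → unitInterval) → ℝ} (hC : IsCopula C)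
    (hC' : IsCopula C') (h : ∀ u : Fin d → unitInterval, (∀ i, (u i : ℝ) ∈ Set.Ioo (0 : ℝ) 1) →
      C u = C' u) : C = C' := by
  have hd : Dense (Set.pi Set.univ fun _ : Fin d => Set.Ioo (0 : unitInterval) 1) := by
    refine dense_pi _ fun i _ => ?_
    rw [dense_iff_closure_eq, closure_Ioo zero_ne_one]
    exact Set.eq_univ_of_forall fun x => ⟨bot_le, le_top⟩
  refine Continuous.ext_on hd hC.continuous hC'.continuous fun u hu => h u fun i => ?_
  exact ⟨(hu i trivial).1, (hu i trivial).2⟩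

section RandomVector

variable {Ω : Type*} [MeasurableSpace Ω] {P : Measure Ω} [IsProbabilityMeasure P]
  {Y : Ω → Vec d}

lemma isProbabilityMeasure_map_coord (hY : Measurable Y) (i : Fin d) :
    IsProbabilityMeasure (P.map fun ω => Y ω i) :=
  Measure.isProbabilityMeasure_map ((measurable_coord i).comp hY).aemeasurable

/-- The existence part of Sklar's theorem for atomless marginals. -/
theorem exists_isCopulaOf (hY : Measurable Y)
    (hna : ∀ i, NullSingletonClass (P.map fun ω => Y ω i)) : ∃ C, IsCopulaOf C Y P := by
  have hprob := isProbabilityMeasure_map_coord (P := P) hY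
  have hYi : ∀ i, Measurable fun ω => Y ω i := fun i => (measurable_coord i).comp hY
  have hcdf : ∀ i, Measurable (cdf (P.map fun ω => Y ω i)) := fun i => (monotone_cdf _).measurable
  -- The copula is the distribution function of the vector of the `F_i(Y_i)`, uniform by the
  -- probability integral transform.
  set Z : Ω → Fin d → ℝ := fun ω i => cdf (P.map fun ω => Y ω i) (Y ω i) with hZ
  have hZm : Measurable Z := measurable_pi_iff.2 fun i => (hcdf i).comp (hYi i)
  have hmarg : ∀ i, P.map (fun ω => Z ω i) = volume.restrict (Set.Icc (0 : ℝ) 1) := by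
    intro i
    rw [← map_cdf_eq (P.map fun ω => Y ω i), Measure.map_map (hcdf i) (hYi i)]
    rfl
  refine ⟨fun u => (P.map Z).real {y | ∀ i, y i ≤ u i}, ⟨P.map Z,
    Measure.isProbabilityMeasure_map hZm.aemeasurable, fun i => ?_, fun u => rfl⟩, fun x => ?_⟩
  · rw [Measure.map_map (measurable_pi_apply i) hZm]
    exact hmarg i
  · refine Eq.trans ?_ (map_measureReal_apply hZm (measurableSet_forall_le fun i =>
      (marginalCDF Y P i (x i) : ℝ))).symm
    refine measureReal_congr ?_
    -- Where `F_i` is flat, `F_i(Y_i) ≤ F_i(x_i)` does not imply `Y_i ≤ x_i`; this fails only on the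
    -- event of equality, which is null because `Z_i` is uniform.
    have hne : ∀ᵐ ω ∂P, ∀ i, Z ω i ≠ cdf (P.map fun ω => Y ω i) (x i) := by
      refine ae_all_iff.2 fun i => ?_
      have h0 : P.map (fun ω => Z ω i) {cdf (P.map fun ω => Y ω i) (x i)} = 0 := by
        rw [hmarg]
        exact measure_singleton _
      rw [Measure.map_apply (measurable_pi_iff.1 hZm i) (measurableSet_singleton _)] at h0
      rw [ae_iff]
      refine measure_mono_null (fun ω hω => ?_) h0
      simpa using hω
    filter_upwards [hne] with ω hω
    refine propext (forall_congr' fun i => ⟨fun h => monotone_cdf _ h, fun h => ?_⟩)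
    by_contra! hlt
    exact hω i (le_antisymm h (monotone_cdf _ hlt.le))

/-- The uniqueness part of Sklar's theorem for atomless marginals. -/
theorem IsCopulaOf.unique (hY : Measurable Y)
    (hna : ∀ i, NullSingletonClass (P.map fun ω => Y ω i)) {C C' : (Fin d → unitInterval) → ℝ}
    (hC : IsCopulaOf C Y P) (hC' : IsCopulaOf C' Y P) : C = C' := by
  have hprob := isProbabilityMeasure_map_coord (P := P) hY
  refine hC.1.eq_of_eqOn_Ioo hC'.1 fun u hu => ?_
  choose x hx using fun i => exists_cdf_eq (P.map fun ω => Y ω i) (hu i)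
  have hux : u = fun i => marginalCDF Y P i (x i) := funext fun i => Subtype.ext (hx i).symm
  rw [hux, ← hC.2, ← hC'.2]

/-- Copulas are invariant under increasing affine transformations of the coordinates. -/
theorem isCopulaOf_iff_of_map_eq {Y' : Ω → Vec d} (hY : Measurable Y) (hY' : Measurable Y')
    {a : Fin d → ℝ} (ha : ∀ i, 0 < a i) {b : Vec d}
    (hlaw : P.map Y' = P.map fun ω => WithLp.toLp 2 (fun i => a i * Y ω i) + b)
    (C : (Fin d → unitInterval) → ℝ) : IsCopulaOf C Y' P ↔ IsCopulaOf C Y P := by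
  set Z : Ω → Vec d := fun ω => WithLp.toLp 2 (fun i => a i * Y ω i) + b with hZ
  have hYi : ∀ i, Measurable fun ω => Y ω i := fun i => (measurable_coord i).comp hY
  have hZm : Measurable Z := by fun_prop
  have hZi : ∀ i, Measurable fun ω => Z ω i := fun i => (measurable_coord i).comp hZm
  have hprob := isProbabilityMeasure_map_coord (P := P) hY
  have hprob' := isProbabilityMeasure_map_coord (P := P) hY'
  have hprobZ := isProbabilityMeasure_map_coord (P := P) hZm
  have hle : ∀ ω i x, Z ω i ≤ a i * x + b i ↔ Y ω i ≤ x := by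
    intro ω i x
    change a i * Y ω i + b i ≤ _ ↔ _
    rw [add_le_add_iff_right, mul_le_mul_iff_right₀ (ha i)]
  have hjoint : ∀ x : Fin d → ℝ, P.real {ω | ∀ i, Y' ω i ≤ a i * x i + b i} =
      P.real {ω | ∀ i, Y ω i ≤ x i} := by
    intro x
    have hS : MeasurableSet {y : Vec d | ∀ i, y i ≤ a i * x i + b i} := by
      rw [Set.ofPred_forall]
      exact MeasurableSet.iInter fun i => measurableSet_le (measurable_coord i) measurable_const
    have h1 := congrArg (fun μ => μ.real {y : Vec d | ∀ i, y i ≤ a i * x i + b i}) hlaw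
    simp only [map_measureReal_apply hY' hS, map_measureReal_apply hZm hS] at h1
    refine h1.trans (congrArg _ ?_)
    ext ω
    exact forall_congr' fun i => hle ω i (x i)
  have hcdf : ∀ i x, marginalCDF Y' P i (a i * x + b i) = marginalCDF Y P i x := by
    intro i x
    have hlawi : (P.map fun ω => Y' ω i) = P.map fun ω => Z ω i := by
      have := congrArg (Measure.map fun y : Vec d => y i) hlaw
      rwa [Measure.map_map (measurable_coord i) hY', Measure.map_map (measurable_coord i) hZm]
        at this
    refine Subtype.ext ?_
    simp only [marginalCDF, hlawi, cdf_eq_real]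
    rw [map_measureReal_apply (hZi i) measurableSet_Iic,
      map_measureReal_apply (hYi i) measurableSet_Iic]
    congr 1
    ext ω
    exact hle ω i x
  refine and_congr_right fun _ => ⟨fun h x => ?_, fun h x => ?_⟩
  · have := h fun i => a i * x i + b i
    rwa [hjoint, funext fun i => hcdf i (x i)] at this
  · have hx : x = fun i => a i * ((x i - b i) / a i) + b i := by
      ext i
      rw [mul_div_cancel₀ _ (ha i).ne', sub_add_cancel]
    rw [hx, hjoint, h, funext fun i => hcdf i ((x i - b i) / a i)]

end RandomVector

end

end HeteroStable

end

/-! ### The proposition. -/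

theorem proposition5p2 {d : ℕ} {Ω : Type*} [MeasurableSpace Ω] (P : MeasureTheory.Measure Ω)
    [MeasureTheory.IsProbabilityMeasure P]
    (N : Seminorm ℝ (HeteroStable.Vec d)) (hN : ∀ x, N x = 0 → x = 0)
    (Λs Λ : MeasureTheory.Measure (HeteroStable.Vec d)) (α cp cm : Fin d → ℝ)
    (X : ℝ≥0 → Ω → HeteroStable.Vec d)
    (hX : HeteroStable.IsHeteroStableProcess N Λs α cp cm Λ X P) :
    HeteroStable.Explosive Λ ∧
    (∃ γ : ℝ≥0 → HeteroStable.Vec d, ∀ t : ℝ≥0,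
      ProbabilityTheory.IdentDistrib (X t)
        (fun ω => WithLp.toLp 2 (fun i => (t : ℝ) ^ (1 / α i) * X 1 ω i + γ t i)) P P) ∧
    (∃ C : (Fin d → unitInterval) → ℝ, ∀ t : ℝ≥0, 0 < t →
      ∀ C' : (Fin d → unitInterval) → ℝ,
        HeteroStable.IsCopulaOf C' (X t) P ↔ C' = C) := by
  have hm := hX.isLevyProcess.measurable
  choose γ hγ using hX.exists_map_eq hN
  refine ⟨hX.measure.explosive, ⟨γ, fun t => ⟨(hm t).aemeasurable, ?_, hγ t⟩⟩, ?_⟩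
  · exact (((HeteroStable.measurable_scaling α t).comp (hm 1)).add_const (γ t)).aemeasurable
  · have hna := hX.noAtoms_map_coord hN
    obtain ⟨C, hC⟩ := HeteroStable.exists_isCopulaOf (hm 1) hna
    refine ⟨C, fun t ht C' => ?_⟩
    rw [HeteroStable.isCopulaOf_iff_of_map_eq (hm 1) (hm t)
      (fun i => Real.rpow_pos_of_pos (by exact_mod_cast ht) (1 / α i)) (hγ t)]
    exact ⟨fun h => h.unique (hm 1) hna hC, fun h => h ▸ hC⟩
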